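/- **Setting.** Let $\sigma_0=\begin{pmatrix}0&-\mathbf 1\\ \mathbf 1&0\end{pmatrix}$ ($2\times2$ blocks), let $\Sigma$ be the orbit of $\sigma_0$ under $\sigma\mapsto\Lambda\sigma\Lambda^t$ with $\Lambda$ in the full Lorentz group, and let $\Sigma_1\subset\Sigma$ be the orbit of $\sigma_0$ under $O(\mathbb R^3)$. Let $\mathcal E^{(m)}$ be the enveloping C*-algebra of the regular (Weyl) representations of $m$ quantum coordinates with common commutator, $[q_i^\mu,q_j^\nu]=i\delta_{ij}Q^{\mu\nu}$, $Q$ central with spectrum in $\Sigma$; it is generated by the elements $g(Q)f(q_1,\dots,q_m)$ with $g\in\mathcal C_0(\Sigma)$, $\check f\in L^1(\mathbb R^{4m})$, where $$f(q_1,\dots,q_m)=\int_{\mathbb R^{4m}}dk\,\check f(k_1,\dots,k_m)\,e^{i(k_1q_1+\dots+k_mq_m)},\qquad e^{ikq}e^{ihq}=e^{-\frac i2k_\mu h_\nu Q^{\mu\nu}}e^{i(k+h)q}.$$ Let $\mathcal E_1$ be the corresponding algebra for $m=1$ over $\Sigma_1$, $\gamma$ the restriction to $\Sigma_1$, and $\eta$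 the localization map, $\langle\eta,e^{ikq}\rangle=e^{-\frac12\sum_{\mu=0}^3k_\mu^2}$ at every $\sigma\in\Sigma_1$. For $n\ge1$ denote the coordinates of $\mathcal E^{(n+1)}$ by $q_0,q_1,\dots,q_n$, and let $\tilde q=q_0/\sqrt n$, so that $[\tilde q^\mu,\tilde q^\nu]=\frac in Q^{\mu\nu}$. Let $\beta^{(n)}:\mathcal E^{(n)}\to M(\mathcal E^{(n+1)})$ be the *-homomorphism with $\beta^{(n)}(q_i)=\tilde q+\frac1n\sum_j(q_i-q_j)$, and let $$E^{(n)}=(\gamma\otimes_Z\eta\otimes_Z\dots\otimes_Z\eta)\circ\beta^{(n)}$$ ($n$ factors $\eta$) be the quantum diagonal map, extended normally to the multiplier algebra $M(\mathcal E^{(n)})$. In the target algebra, $\tilde q=q/\sqrt n$. **Proposition.** Let $n\ge1$, $f\in\mathcal C_0(\mathbb R^{4n})$ with $\check f\in L^1(\mathbb R^{4n})$, i.e. $f(x)=\int dk\,\check f(k)e^{i(k_1x_1+\dots+k_nx_n)}$. Then $$E^{(n)}(f(q_1,\dots,q_n))=\int_{\mathbb R^{4n}}dk_1\cdots dk_n\,\check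 f(k_1,\dots,k_n)\,r_n(k_1,\dots,k_n)\,e^{i(\sum_ik_i)\tilde q},$$ $$r_n(k_1,\dots,k_n)=\exp\Big\{-\tfrac12\sum_{\mu=0}^3\Big(\sum_{j=1}^nk_{j\mu}^2-\tfrac1n\sum_{j,l=1}^nk_{j\mu}k_{l\mu}\Big)\Big\}.$$ Equivalently, $E^{(n)}(f(q_1,\dots,q_n))=h(\tilde q)=\int_{\mathbb R^4}dk\,\check h(k)e^{ik\tilde q}$, where $h\in\mathcal C_0(\mathbb R^4)$, $\check h\in L^1(\mathbb R^4)$, and $$h(x)=c_n\int_{\mathbb R^{4n}}da_1\cdots da_n\,f(x+a_1,\dots,x+a_n)\,e^{-\frac12|a_1|^2-\dots-\frac12|a_n|^2}\,\delta^{(4)}\Big(\frac1n\sum_{j=1}^na_j\Big),\qquad c_n=n^{-2}(2\pi)^{-2(n-1)},$$ with $|a|^2=\sum_{\mu=0}^3a_\mu^2$. In particular $E^{(n)}(f(q_1,\dots,q_n))$ belongs to $\mathcal E_1$ and is a constant function of $\sigma\in\Sigma_1$ (its symbol does not depend on $\sigma$). -/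

import Mathlib

open MeasureTheory Filter Topology
open scoped ENNReal ZeroAtInfty InnerProductSpace Matrix BoundedContinuousFunction

noncomputable section
namespace QuantumSpacetime

/-! ### Points, momenta, and the manifolds of commutators -/

/-- `ℝ^{4m}`: `m`-tuples of four-vectors (positions `x_j^μ`, or momenta `k_{jμ}`), with Lebesgue
measure `volume`. -/
abbrev Pt (m : ℕ) := Fin m → Fin 4 → ℝ

variable {m n : ℕ} {σ : Matrix (Fin 4) (Fin 4) ℝ}

/-- The standard symplectic matrix `(0, -1; 1, 0)` in `2 × 2` blocks. -/
def sigmaZero : Matrix (Fin 4) (Fin 4) ℝ :=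
  !![0, 0, -1, 0; 0, 0, 0, -1; 1, 0, 0, 0; 0, 1, 0, 0]

/-- The Minkowski metric `diag(1,-1,-1,-1)`. -/
def minkowski : Matrix (Fin 4) (Fin 4) ℝ := Matrix.diagonal ![1, -1, -1, -1]

/-- The manifold `Σ`: the orbit of `σ₀` under `σ ↦ Λ σ Λᵀ`, `Λ` in the full Lorentz group. -/
def Sig : Set (Matrix (Fin 4) (Fin 4) ℝ) :=
  {σ | ∃ Λ : Matrix (Fin 4) (Fin 4) ℝ, Λᵀ * minkowski * Λ = minkowski ∧ σ = Λ * sigmaZero * Λᵀ}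

/-- The embedding `O(ℝ³) → O(1,3)`, `R ↦ diag(1, R)`. -/
def spatial (R : Matrix (Fin 3) (Fin 3) ℝ) : Matrix (Fin 4) (Fin 4) ℝ :=
  !![1, 0, 0, 0; 0, R 0 0, R 0 1, R 0 2; 0, R 1 0, R 1 1, R 1 2; 0, R 2 0, R 2 1, R 2 2]

/-- The distinguished subset `Σ₁ ⊆ Σ`: the orbit of `σ₀` under `O(ℝ³)`. -/
def SigOne : Set (Matrix (Fin 4) (Fin 4) ℝ) :=
  {σ | ∃ R ∈ Matrix.orthogonalGroup (Fin 3) ℝ, σ = spatial R * sigmaZero * (spatial R)ᵀ}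

theorem spatial_lorentz {R : Matrix (Fin 3) (Fin 3) ℝ} (hR : R ∈ Matrix.orthogonalGroup (Fin 3) ℝ) :
    (spatial R)ᵀ * minkowski * spatial R = minkowski := by
  have h := (Matrix.mem_orthogonalGroup_iff' (Fin 3) ℝ).1 hR
  have h' : ∀ i j, ∑ l, R l i * R l j = (1 : Matrix (Fin 3) (Fin 3) ℝ) i j := by
    intro i j; rw [← h]; simp [Matrix.mul_apply]
  simp only [Fin.sum_univ_three] at h'
  have a00 := h' 0 0; have a01 := h' 0 1; have a02 := h' 0 2
  have a11 := h' 1 1; have a12 := h' 1 2; have a22 := h' 2 2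
  simp at a00 a01 a02 a11 a12 a22
  ext i j
  fin_cases i <;> fin_cases j <;>
    simp [spatial, minkowski, Matrix.mul_apply, Fin.sum_univ_four, Matrix.diagonal] <;> linarith

theorem spatial_orthogonal {R : Matrix (Fin 3) (Fin 3) ℝ}
    (hR : R ∈ Matrix.orthogonalGroup (Fin 3) ℝ) : (spatial R)ᵀ * spatial R = 1 := by
  have h := (Matrix.mem_orthogonalGroup_iff' (Fin 3) ℝ).1 hR
  have h' : ∀ i j, ∑ l, R l i * R l j = (1 : Matrix (Fin 3) (Fin 3) ℝ) i j := by
    intro i j; rw [← h]; simp [Matrix.mul_apply]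
  simp only [Fin.sum_univ_three] at h'
  have a00 := h' 0 0; have a01 := h' 0 1; have a02 := h' 0 2
  have a11 := h' 1 1; have a12 := h' 1 2; have a22 := h' 2 2
  simp at a00 a01 a02 a11 a12 a22
  ext i j
  fin_cases i <;> fin_cases j <;>
    simp [spatial, Matrix.mul_apply, Fin.sum_univ_four] <;> linarith

theorem SigOne_subset_Sig : SigOne ⊆ Sig := by
  rintro _ ⟨R, hR, rfl⟩
  exact ⟨spatial R, spatial_lorentz hR, rfl⟩

theorem sigmaZero_transpose : sigmaZeroᵀ = -sigmaZero := by
  ext i j; fin_cases i <;> fin_cases j <;> simp [sigmaZero]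

theorem sigmaZero_orthogonal : sigmaZero * sigmaZeroᵀ = 1 := by
  ext i j; fin_cases i <;> fin_cases j <;> simp [sigmaZero, Matrix.mul_apply, Fin.sum_univ_four]

theorem SigOne_antisymm {σ : Matrix (Fin 4) (Fin 4) ℝ} (h : σ ∈ SigOne) : σᵀ = -σ := by
  obtain ⟨R, hR, rfl⟩ := h
  simp [Matrix.transpose_mul, sigmaZero_transpose, Matrix.mul_assoc]

theorem SigOne_orthogonal {σ : Matrix (Fin 4) (Fin 4) ℝ} (h : σ ∈ SigOne) : σ * σᵀ = 1 := by
  obtain ⟨R, hR, rfl⟩ := h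
  have h1 := spatial_orthogonal hR
  have h2 : spatial R * (spatial R)ᵀ = 1 := mul_eq_one_comm.1 h1
  calc spatial R * sigmaZero * (spatial R)ᵀ * (spatial R * sigmaZero * (spatial R)ᵀ)ᵀ
      = spatial R * sigmaZero * ((spatial R)ᵀ * spatial R) * sigmaZeroᵀ * (spatial R)ᵀ := by
        simp only [Matrix.transpose_mul, Matrix.transpose_transpose, Matrix.mul_assoc]
    _ = 1 := by
        rw [h1, Matrix.mul_one, Matrix.mul_assoc (spatial R), sigmaZero_orthogonal, Matrix.mul_one,
          h2]

/-! ### Regular representations of the commutation relations -/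

/-- The form `∑_j k_{jμ} h_{jν} σ^{μν}`. -/
def twist (σ : Matrix (Fin 4) (Fin 4) ℝ) (k h : Pt m) : ℝ :=
  ∑ j, ∑ μ, ∑ ν, k j μ * h j ν * σ μ ν

/-- A regular representation, at the point `σ`, of `m` independent quantum coordinates
`q_1, …, q_m` with common commutator, `[q_i^μ, q_j^ν] = i δ_{ij} σ^{μν}`, given in Weyl form by the
strongly continuous family `W k = exp(i (k_1 q_1 + ⋯ + k_m q_m))`, i.e.
`e^{ikq} e^{ihq} = e^{-(i/2) k_μ h_ν σ^{μν}} e^{i(k+h)q}` in each coordinate. (The `W k` are unitary,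
as `W k (W (-k))` is a multiple of `W 0 = 1` by a phase.) -/
structure WeylRep (m : ℕ) (σ : Matrix (Fin 4) (Fin 4) ℝ) : Type 1 where
  K : Type
  [instN : NormedAddCommGroup K]
  [instI : InnerProductSpace ℂ K]
  [instC : CompleteSpace K]
  W : Pt m → K →ₗᵢ[ℂ] K
  W_zero : W 0 = LinearIsometry.id
  W_mul : ∀ k h v, W k (W h v) = Complex.exp (-(Complex.I / 2) * (twist σ k h : ℂ)) • W (k + h) v
  W_cont : ∀ v, Continuous fun k => W k v

attribute [instance] WeylRep.instN WeylRep.instI WeylRep.instC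

section Integ
variable {X : Type} [TopologicalSpace X] [SecondCountableTopology X] [MeasureSpace X] [BorelSpace X]

theorem WeylRep.integrable_smul (π : WeylRep m σ) (u : C(X, Pt m)) {φ : X → ℂ}
    (hφ : Integrable φ) (v : π.K) : Integrable fun x => φ x • π.W (u x) v := by
  refine hφ.smul_bdd (C := ‖v‖) ?_ ?_
  · exact ((π.W_cont v).comp u.continuous).aestronglyMeasurable
  · exact Eventually.of_forall fun x => by simp

open Classical in
/-- The bounded operator `∫ dx φ(x) e^{i u(x) q}` (a strongly convergent integral), for `φ ∈ L¹`.
For `X = ℝ^{4m}`, `u = id`, `φ = f̌` this is `f(q_1, …, q_m)` in the representation `π`.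
(Convention: `0` if `φ` is not integrable.) -/
def WeylRep.smear (π : WeylRep m σ) (u : C(X, Pt m)) (φ : X → ℂ) : π.K →L[ℂ] π.K :=
  if hφ : Integrable φ then
    LinearMap.mkContinuous
      { toFun := fun v => ∫ x, φ x • π.W (u x) v
        map_add' := fun v w => by
          simp only [map_add, smul_add]
          exact integral_add (π.integrable_smul u hφ v) (π.integrable_smul u hφ w)
        map_smul' := fun c v => by
          simp only [map_smul, smul_comm _ c, RingHom.id_apply]
          exact integral_smul c _ }
      (∫ x, ‖φ x‖) fun v => by
        refine (norm_integral_le_integral_norm _).trans (le_of_eq ?_)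
        simp [norm_smul, integral_mul_const]
  else 0

theorem WeylRep.norm_smear_le (π : WeylRep m σ) (u : C(X, Pt m)) (φ : X → ℂ) :
    ‖π.smear u φ‖ ≤ ∫ x, ‖φ x‖ := by
  have h0 : 0 ≤ ∫ x, ‖φ x‖ := integral_nonneg fun x => norm_nonneg _
  unfold WeylRep.smear
  split_ifs
  · exact LinearMap.mkContinuous_norm_le _ h0 _
  · simpa using h0
end Integ

/-! ### The C*-algebras -/

/-- All regular representations of `m` coordinates at the points `σ` of `S`. -/
def Rep (S : Set (Matrix (Fin 4) (Fin 4) ℝ)) (m : ℕ) : Type 1 :=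
  Σ σ : S, WeylRep m (σ : Matrix (Fin 4) (Fin 4) ℝ)

/-- The C*-algebra of bounded families of operators `A = (A_π)_π`, `π` running through all regular
representations over `S`, with the norm `sup_π ‖A_π‖`. The enveloping C*-algebras below are
realized in it. -/
def Sections (S : Set (Matrix (Fin 4) (Fin 4) ℝ)) (m : ℕ) : Type 1 :=
  lp (fun π : Rep S m => π.2.K →L[ℂ] π.2.K) ∞

instance (S : Set (Matrix (Fin 4) (Fin 4) ℝ)) (m : ℕ) : NonUnitalCStarAlgebra (Sections S m) :=
  letI : NonUnitalCStarAlgebra (lp (fun π : Rep S m => π.2.K →L[ℂ] π.2.K) ∞) :=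
    { lp.nonUnitalNormedRing, lp.inftyStarRing with
      toCompleteSpace := inferInstance
      toCStarRing := lp.inftyCStarRing
      toNormedSpace := inferInstance
      toIsScalarTower := lp.infty_isScalarTower
      toSMulCommClass := lp.infty_smulCommClass
      toStarModule := inferInstance }
  this

section Sections
variable {S : Set (Matrix (Fin 4) (Fin 4) ℝ)}

/-- The component `A_π` of `A` in the representation `π`. -/
def Sections.eval (A : Sections S m) (π : Rep S m) : π.2.K →L[ℂ] π.2.K :=
  (show lp (fun π : Rep S m => π.2.K →L[ℂ] π.2.K) ∞ from A) π

theorem Sections.ext {A B : Sections S m} (h : ∀ π, A.eval π = B.eval π) : A = B :=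
  lp.ext (E := fun π : Rep S m => π.2.K →L[ℂ] π.2.K) (funext h)

theorem Sections.norm_eval_le (A : Sections S m) (π : Rep S m) : ‖A.eval π‖ ≤ ‖A‖ :=
  lp.norm_apply_le_norm (E := fun π : Rep S m => π.2.K →L[ℂ] π.2.K) (by simp) A π

theorem Sections.eval_add (A B : Sections S m) (π : Rep S m) :
    (A + B).eval π = A.eval π + B.eval π := rfl

theorem Sections.eval_zero (π : Rep S m) : (0 : Sections S m).eval π = 0 := rfl

theorem Sections.eval_mul (A B : Sections S m) (π : Rep S m) :
    (A * B).eval π = A.eval π * B.eval π := rfl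

theorem Sections.eval_smul (c : ℂ) (A : Sections S m) (π : Rep S m) :
    (c • A).eval π = c • A.eval π := rfl

theorem Sections.eval_star (A : Sections S m) (π : Rep S m) :
    (star A).eval π = star (A.eval π) := rfl

/-- A uniformly bounded family of operators as an element of `Sections`. -/
def Sections.mk (F : ∀ π : Rep S m, π.2.K →L[ℂ] π.2.K) (C : ℝ) (h : ∀ π, ‖F π‖ ≤ C) :
    Sections S m :=
  ⟨F, memℓp_infty ⟨C, by rintro _ ⟨π, rfl⟩; exact h π⟩⟩

theorem Sections.eval_mk (F : ∀ π : Rep S m, π.2.K →L[ℂ] π.2.K) (C : ℝ) (h : ∀ π, ‖F π‖ ≤ C)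
    (π : Rep S m) : (Sections.mk F C h).eval π = F π := rfl

/-- The family `g(Q) ∫ dx φ(x) e^{i u(x) q}`, where `g(Q)` acts as `g(σ)` at the point `σ`. -/
def quantize {X : Type} [TopologicalSpace X] [SecondCountableTopology X] [MeasureSpace X]
    [BorelSpace X] (g : S →ᵇ ℂ) (u : C(X, Pt m)) (φ : X → ℂ) : Sections S m :=
  Sections.mk (fun π => g π.1 • π.2.smear u φ) (‖g‖ * ∫ x, ‖φ x‖) fun π => by
    rw [norm_smul]
    exact mul_le_mul (g.norm_coe_le_norm _) (π.2.norm_smear_le u φ) (norm_nonneg _) (norm_nonneg _)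

/-- The enveloping C*-algebra of the generalized symbols of `m` coordinates over `S`, generated by
the elements `g(Q) f(q_1, …, q_m)`, `g ∈ C₀(S)`, `f̌ = φ ∈ L¹(ℝ^{4m})`. For `S = Σ` this is
`ℰ^{(m)} = ℰ ⊗_Z ⋯ ⊗_Z ℰ`, and `ℰ₁` is the case `S = Σ₁`, `m = 1`. -/
def symbolAlgebra (S : Set (Matrix (Fin 4) (Fin 4) ℝ)) (m : ℕ) :
    NonUnitalStarSubalgebra ℂ (Sections S m) :=
  (NonUnitalStarAlgebra.adjoin ℂ
    {A | ∃ (g : C₀(S, ℂ)) (φ : Pt m → ℂ), Integrable φ ∧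
      A = quantize g.toBCF (ContinuousMap.id _) φ}).topologicalClosure

/-- The multiplier algebra of `symbolAlgebra S m` (as the idealizer: the algebra is represented
nondegenerately in `Sections S m`). -/
def multiplierAlgebra (S : Set (Matrix (Fin 4) (Fin 4) ℝ)) (m : ℕ) :
    NonUnitalStarSubalgebra ℂ (Sections S m) where
  carrier := {A | ∀ B ∈ symbolAlgebra S m, A * B ∈ symbolAlgebra S m ∧ B * A ∈ symbolAlgebra S m}
  add_mem' hA hB C hC := by
    rw [add_mul, mul_add]
    exact ⟨add_mem (hA C hC).1 (hB C hC).1, add_mem (hA C hC).2 (hB C hC).2⟩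
  zero_mem' C _ := by
    rw [zero_mul, mul_zero]
    exact ⟨zero_mem _, zero_mem _⟩
  mul_mem' {A B} hA hB C hC := by
    rw [mul_assoc, ← mul_assoc C]
    exact ⟨(hA _ (hB C hC).1).1, (hB _ (hA C hC).2).2⟩
  smul_mem' c A hA C hC := by
    rw [smul_mul_assoc, mul_smul_comm]
    exact ⟨SMulMemClass.smul_mem c (hA C hC).1, SMulMemClass.smul_mem c (hA C hC).2⟩
  star_mem' {A} hA C hC := by
    have h := hA (star C) (star_mem hC)
    have h1 := star_mem h.1
    have h2 := star_mem h.2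
    rw [star_mul, star_star] at h1 h2
    exact ⟨h2, h1⟩

theorem exists_mul_eq {Y : Type*} [TopologicalSpace Y] (g : C₀(Y, ℂ)) :
    ∃ g₁ g₂ : C₀(Y, ℂ), ∀ y, g₁ y * g₂ y = g y := by
  have hz : Tendsto (fun y => √‖g y‖) (cocompact Y) (𝓝 0) := by
    have h := (Real.continuous_sqrt.comp continuous_norm).tendsto (0 : ℂ) |>.comp g.zero_at_infty'
    simpa [Function.comp_def] using h
  have hn : ∀ z : ℂ, ‖z / (√‖z‖ : ℝ)‖ = √‖z‖ := fun z => by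
    rw [norm_div, Complex.norm_real, Real.norm_of_nonneg (Real.sqrt_nonneg _), Real.div_sqrt]
  have hc : Continuous fun z : ℂ => z / (√‖z‖ : ℝ) := by
    rw [continuous_iff_continuousAt]
    intro z
    by_cases hz0 : z = 0
    · subst hz0
      have : Tendsto (fun z : ℂ => ‖z / (√‖z‖ : ℝ)‖) (𝓝 0) (𝓝 0) := by
        simp_rw [hn]
        have h := (Real.continuous_sqrt.comp continuous_norm).tendsto (0 : ℂ)
        simpa [Function.comp_def] using h
      have h2 := tendsto_zero_iff_norm_tendsto_zero.2 this
      simpa [ContinuousAt] using h2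
    · refine ContinuousAt.div continuousAt_id (by fun_prop) ?_
      exact_mod_cast (Real.sqrt_pos.2 (norm_pos_iff.2 hz0)).ne'
  refine ⟨⟨⟨fun y => ((√‖g y‖ : ℝ) : ℂ), by fun_prop⟩, ?_⟩,
    ⟨⟨fun y => g y / (√‖g y‖ : ℝ), hc.comp g.continuous⟩, ?_⟩, fun y => ?_⟩
  · have h := (Complex.continuous_ofReal.tendsto 0).comp hz
    simpa [Function.comp_def] using h
  · rw [tendsto_zero_iff_norm_tendsto_zero]
    simp only [hn]
    exact hz
  · change ((√‖g y‖ : ℝ) : ℂ) * (g y / (√‖g y‖ : ℝ)) = g y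
    by_cases h0 : g y = 0
    · simp [h0]
    · have : ((√‖g y‖ : ℝ) : ℂ) ≠ 0 := by
        exact_mod_cast (Real.sqrt_pos.2 (norm_pos_iff.2 h0)).ne'
      field_simp

theorem quantize_mem (g : C₀(S, ℂ)) {φ : Pt m → ℂ} (hφ : Integrable φ) :
    quantize g.toBCF (ContinuousMap.id _) φ ∈ symbolAlgebra S m :=
  NonUnitalStarSubalgebra.le_topologicalClosure _
    (NonUnitalStarAlgebra.subset_adjoin ℂ _ ⟨g, φ, hφ, rfl⟩)

theorem quantize_one_mem (φ : Pt m → ℂ) :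
    quantize (1 : S →ᵇ ℂ) (ContinuousMap.id _) φ ∈ multiplierAlgebra S m := by
  by_cases hφ : Integrable φ
  swap
  · have : quantize (1 : S →ᵇ ℂ) (ContinuousMap.id (Pt m)) φ = 0 :=
      Sections.ext fun π => by
        simp [quantize, Sections.eval_mk, WeylRep.smear, hφ, Sections.eval_zero]
    rw [this]; exact zero_mem _
  set F := quantize (1 : S →ᵇ ℂ) (ContinuousMap.id (Pt m)) φ with hF
  have gen : ∀ (g : C₀(S, ℂ)) (φ' : Pt m → ℂ), Integrable φ' → ∀ B,
      B = quantize g.toBCF (ContinuousMap.id _) φ' →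
      (F * B ∈ symbolAlgebra S m ∧ B * F ∈ symbolAlgebra S m) ∧
      (F * star B ∈ symbolAlgebra S m ∧ star B * F ∈ symbolAlgebra S m) := by
    rintro g φ' hφ' _ rfl
    obtain ⟨g₁, g₂, hg⟩ := exists_mul_eq g
    have hg' : ∀ y, g y = g₂ y * g₁ y := fun y => by rw [mul_comm, hg]
    obtain ⟨g₃, g₄, hs⟩ := exists_mul_eq (star g)
    have hs' : ∀ y, star (g y) = g₃ y * star (star (g₄ y)) := fun y => by
      rw [star_star, hs]; rfl
    have hs2 : ∀ y, star (g y) = star (star (g₃ y)) * g₄ y := fun y => by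
      rw [star_star, hs]; rfl
    refine ⟨⟨?_, ?_⟩, ⟨?_, ?_⟩⟩
    · have : F * quantize g.toBCF (ContinuousMap.id _) φ' =
          quantize g₁.toBCF (ContinuousMap.id _) φ * quantize g₂.toBCF (ContinuousMap.id _) φ' := by
        refine Sections.ext fun π => ?_
        simp only [hF, quantize, Sections.eval_mul, Sections.eval_mk, smul_mul_smul_comm]
        congr 1
        change 1 * g π.1 = g₁ π.1 * g₂ π.1
        rw [hg, one_mul]
      rw [this]
      exact mul_mem (quantize_mem g₁ hφ) (quantize_mem g₂ hφ')
    · have : quantize g.toBCF (ContinuousMap.id _) φ' * F =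
          quantize g₁.toBCF (ContinuousMap.id _) φ' * quantize g₂.toBCF (ContinuousMap.id _) φ := by
        refine Sections.ext fun π => ?_
        simp only [hF, quantize, Sections.eval_mul, Sections.eval_mk, smul_mul_smul_comm]
        congr 1
        change g π.1 * 1 = g₁ π.1 * g₂ π.1
        rw [hg, mul_one]
      rw [this]
      exact mul_mem (quantize_mem g₁ hφ') (quantize_mem g₂ hφ)
    · have : F * star (quantize g.toBCF (ContinuousMap.id _) φ') =
          quantize g₃.toBCF (ContinuousMap.id _) φ *
            star (quantize (star g₄).toBCF (ContinuousMap.id _) φ') := by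
        refine Sections.ext fun π => ?_
        simp only [hF, quantize, Sections.eval_mul, Sections.eval_mk, Sections.eval_star,
          star_smul, smul_mul_smul_comm]
        congr 1
        change 1 * star (g π.1) = g₃ π.1 * star (star (g₄ π.1))
        rw [one_mul, hs']
      rw [this]
      exact mul_mem (quantize_mem g₃ hφ) (star_mem (quantize_mem (star g₄) hφ'))
    · have : star (quantize g.toBCF (ContinuousMap.id _) φ') * F =
          star (quantize (star g₃).toBCF (ContinuousMap.id _) φ') *
            quantize g₄.toBCF (ContinuousMap.id _) φ := by
        refine Sections.ext fun π => ?_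
        simp only [hF, quantize, Sections.eval_mul, Sections.eval_mk, Sections.eval_star,
          star_smul, smul_mul_smul_comm]
        congr 1
        change star (g π.1) * 1 = star (star (g₃ π.1)) * g₄ π.1
        rw [mul_one, hs2]
      rw [this]
      exact mul_mem (star_mem (quantize_mem (star g₃) hφ')) (quantize_mem g₄ hφ)
  have hclosed : IsClosed {B : Sections S m |
      F * B ∈ symbolAlgebra S m ∧ B * F ∈ symbolAlgebra S m} := by
    have hE : IsClosed (symbolAlgebra S m : Set (Sections S m)) :=
      NonUnitalStarSubalgebra.isClosed_topologicalClosure _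
    exact (hE.preimage (continuous_const.mul continuous_id)).inter
      (hE.preimage (continuous_id.mul continuous_const))
  intro B hB
  refine closure_minimal ?_ hclosed hB
  intro B hB
  refine NonUnitalAlgebra.adjoin_induction
    (p := fun B _ => F * B ∈ symbolAlgebra S m ∧ B * F ∈ symbolAlgebra S m) ?_ ?_ ?_ ?_ ?_ hB
  · rintro B (⟨g, φ', hφ', rfl⟩ | ⟨g, φ', hφ', h⟩)
    · exact (gen g φ' hφ' _ rfl).1
    · have := (gen g φ' hφ' _ h).2
      rwa [star_star] at this
  · intro B C _ _ hB hC
    rw [mul_add, add_mul]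
    exact ⟨add_mem hB.1 hC.1, add_mem hB.2 hC.2⟩
  · rw [mul_zero, zero_mul]
    exact ⟨zero_mem _, zero_mem _⟩
  · intro B C hB' hC' hB hC
    have hBm : B ∈ symbolAlgebra S m := subset_closure hB'
    have hCm : C ∈ symbolAlgebra S m := subset_closure hC'
    rw [← mul_assoc, mul_assoc B C]
    exact ⟨mul_mem hB.1 hCm, mul_mem hBm hC.2⟩
  · intro c B _ hB
    rw [mul_smul_comm, smul_mul_assoc]
    exact ⟨SMulMemClass.smul_mem c hB.1, SMulMemClass.smul_mem c hB.2⟩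

end Sections

/-- The element `f(q_1, …, q_n) = ∫ dk f̌(k) e^{i(k_1 q_1 + ⋯ + k_n q_n)}` of `M(ℰ^{(n)})`, where
`φ = f̌`. -/
def ofCoordinates (n : ℕ) (φ : Pt n → ℂ) : multiplierAlgebra Sig n :=
  ⟨quantize 1 (ContinuousMap.id _) φ, quantize_one_mem φ⟩

/-! ### The homomorphism `β^{(n)}` -/

/-- The linear map `k ↦ (n^{-1/2} ∑_j k_j, (k_j - n⁻¹ ∑_l k_l)_j)`. It expresses `∑_j k_j 𝐪_j` through
`n + 1` independent coordinates `q_0, q_1, …, q_n`, where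
`𝐪_j = q̃ + n⁻¹ ∑_l (q_j - q_l)` and `q̃ = q_0 / √n` has characteristic length `1 / √n`, that is,
`[q̃^μ, q̃^ν] = (i / n) Q^{μν}`. -/
def meanSplit (n : ℕ) : C(Pt n, Pt (n + 1)) where
  toFun k := Fin.cons ((√n)⁻¹ • ∑ j, k j) fun j => k j - (n : ℝ)⁻¹ • ∑ l, k l
  continuous_toFun := by
    refine continuous_pi fun j => ?_
    refine Fin.cases ?_ (fun j => ?_) j
    · simp only [Fin.cons_zero]; fun_prop
    · simp only [Fin.cons_succ]; fun_prop

theorem twist_meanSplit (k h : Pt n) :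
    twist σ (meanSplit n k) (meanSplit n h) = twist σ k h := by
  rcases Nat.eq_zero_or_pos n with rfl | hn
  · simp [twist, meanSplit]
  have hn' : (n : ℝ) ≠ 0 := by positivity
  have hsq : (√(n : ℝ))⁻¹ * (√(n : ℝ))⁻¹ = (n : ℝ)⁻¹ := by
    rw [← mul_inv, Real.mul_self_sqrt (Nat.cast_nonneg n)]
  have key : ∀ μ ν, ∑ j, (meanSplit n k) j μ * (meanSplit n h) j ν = ∑ j, k j μ * h j ν := by
    intro μ ν
    rw [Fin.sum_univ_succ]
    simp only [meanSplit, ContinuousMap.coe_mk, Fin.cons_zero, Fin.cons_succ, Pi.smul_apply,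
      Pi.sub_apply, Finset.sum_apply, smul_eq_mul]
    set X := ∑ j, k j μ with hX
    set Y := ∑ j, h j ν with hY
    have e : ∀ j, (k j μ - (n : ℝ)⁻¹ * X) * (h j ν - (n : ℝ)⁻¹ * Y) = k j μ * h j ν -
        k j μ * ((n : ℝ)⁻¹ * Y) - (n : ℝ)⁻¹ * X * h j ν + (n : ℝ)⁻¹ * X * ((n : ℝ)⁻¹ * Y) :=
      fun j => by ring
    simp only [e, Finset.sum_add_distrib, Finset.sum_sub_distrib, ← Finset.sum_mul,
      ← Finset.mul_sum, Finset.sum_const, Finset.card_univ, Fintype.card_fin, nsmul_eq_mul,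
      ← hX, ← hY]
    rw [show (√(n : ℝ))⁻¹ * X * ((√(n : ℝ))⁻¹ * Y) = ((√(n : ℝ))⁻¹ * (√(n : ℝ))⁻¹) * (X * Y) by
      ring, hsq]
    field_simp
    ring
  have sw : ∀ {l : ℕ} (a b : Pt l), twist σ a b = ∑ μ, ∑ ν, (∑ j, a j μ * b j ν) * σ μ ν := by
    intro l a b
    unfold twist
    rw [Finset.sum_comm]
    refine Finset.sum_congr rfl fun μ _ => ?_
    rw [Finset.sum_comm]
    exact Finset.sum_congr rfl fun ν _ => (Finset.sum_mul _ _ _).symm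
  rw [sw, sw]
  simp only [key]

theorem meanSplit_zero : meanSplit n 0 = 0 := by
  ext j
  refine Fin.cases ?_ (fun j => ?_) j <;> simp [meanSplit]

theorem meanSplit_add (k h : Pt n) : meanSplit n (k + h) = meanSplit n k + meanSplit n h := by
  ext j μ
  refine Fin.cases ?_ (fun j => ?_) j
  · simp [meanSplit, Finset.sum_add_distrib]
  · simp [meanSplit, Finset.sum_add_distrib]
    ring

/-- In a regular representation of `q_0, …, q_n`, the `𝐪_1, …, 𝐪_n` form again a regular
representation of `n` independent coordinates: `e^{i ∑ k_j 𝐪_j} = W (meanSplit n k)`. -/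
abbrev WeylRep.boldRep (π : WeylRep (n + 1) σ) : WeylRep n σ where
  K := π.K
  W k := π.W (meanSplit n k)
  W_zero := by rw [meanSplit_zero, π.W_zero]
  W_mul k h v := by rw [π.W_mul, twist_meanSplit, meanSplit_add]
  W_cont v := (π.W_cont v).comp (meanSplit n).continuous

/-- The *-homomorphism `β^{(n)}` determined by `β^{(n)}(q_j) = 𝐪_j`, i.e.
`β^{(n)}(g(Q) f(q_1, …, q_n)) = g(Q) f(𝐪_1, …, 𝐪_n)`: the component of `β^{(n)}(A)` in the
representation `π` is the component of `A` in the representation given by the `𝐪_j`. -/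
def beta (n : ℕ) : Sections Sig n →⋆ₙₐ[ℂ] Sections Sig (n + 1) where
  toFun A := Sections.mk (fun π => A.eval ⟨π.1, π.2.boldRep⟩) ‖A‖ fun π => A.norm_eval_le _
  map_smul' _ _ := rfl
  map_zero' := rfl
  map_add' _ _ := rfl
  map_mul' _ _ := rfl
  map_star' _ := rfl

/-! ### The localization map -/

/-- The localization map on plane waves: `⟨η, e^{ikq}⟩ = exp(-½ ∑_μ k_μ²)`, so that
`η(f(q)) = ∫ dk f̌(k) exp(-½ ∑_μ k_μ²)` at every `σ ∈ Σ₁`. -/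
def locWeyl (k : Fin 4 → ℝ) : ℝ := Real.exp (-(1 / 2) * ∑ μ, k μ ^ 2)

/-- The momentum of the zeroth coordinate. -/
def slot (k : Pt (n + 1)) : Pt 1 := fun _ => k 0

/-- A dilation of `π ⊗ η ⊗ ⋯ ⊗ η`, for a regular representation `π` of one coordinate: a regular
representation of the `n + 1` coordinates `q_0, …, q_n` with an isometry `V` such that
`V* e^{i ∑ k_j q_j} V = π(e^{i k_0 q}) ∏_{j=1}^n ⟨η, e^{i k_j q}⟩`. -/
structure LocDilation (n : ℕ) (π : WeylRep 1 σ) : Type 1 where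
  rep : WeylRep (n + 1) σ
  V : π.K →ₗᵢ[ℂ] rep.K
  inner_W : ∀ k v w, ⟪V v, rep.W k (V w)⟫_ℂ =
    (∏ j : Fin n, (locWeyl (k j.succ) : ℂ)) * ⟪v, π.W (slot k) w⟫_ℂ

/-! Construction of a dilation on `L²(ℝ^{4n}; K)`: the coordinates `q_1, …, q_n` act by the left
Moyal multiplication, and `V` is the tensor product with a Gaussian function. -/

/-- The translation `-½ k_{jμ} σ^{μν}` in the argument `x_j^ν`. -/
def shift (σ : Matrix (Fin 4) (Fin 4) ℝ) (k : Pt (n + 1)) : Pt n :=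
  fun j ν => -(1 / 2) * ∑ μ, k j.succ μ * σ μ ν

/-- The plane wave `exp(i ∑_{j=1}^n k_{jμ} x_j^μ)`. -/
def phase (k : Pt (n + 1)) (x : Pt n) : ℂ :=
  Complex.exp (Complex.I * (∑ j, ∑ μ, k j.succ μ * x j μ : ℝ))

theorem norm_phase (k : Pt (n + 1)) (x : Pt n) : ‖phase k x‖ = 1 := by
  unfold phase
  rw [mul_comm]
  exact Complex.norm_exp_ofReal_mul_I _

theorem continuous_phase : Continuous fun p : Pt (n + 1) × Pt n => phase p.1 p.2 := by
  unfold phase; fun_prop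

theorem continuous_shift (σ : Matrix (Fin 4) (Fin 4) ℝ) :
    Continuous (shift σ : Pt (n + 1) → Pt n) := by
  unfold shift; fun_prop

theorem continuous_slot : Continuous (slot : Pt (n + 1) → Pt 1) := by
  unfold slot; fun_prop

abbrev L2 (n : ℕ) (K : Type) [NormedAddCommGroup K] : Type :=
  Lp K 2 (volume : Measure (Pt n))

section
variable (π : WeylRep 1 σ)

theorem memLp_fibre (k : Pt (n + 1)) (ψ : L2 n π.K) :
    MemLp (fun x => phase k x • π.W (slot k) (ψ x)) 2 (volume : Measure (Pt n)) := by
  refine (Lp.memLp ψ).of_le (g := ψ) ?_ (Eventually.of_forall fun x => ?_)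
  · have h1 : Continuous fun x : Pt n => phase k x :=
      continuous_phase.comp (Continuous.prodMk_right k)
    exact h1.aestronglyMeasurable.smul
      ((π.W (slot k)).continuous.comp_aestronglyMeasurable (Lp.aestronglyMeasurable ψ))
  · simp [norm_smul, norm_phase]

/-- Pointwise application of the phase and of `π(e^{i k_0 q})`. -/
def fibre (k : Pt (n + 1)) : L2 n π.K →ₗᵢ[ℂ] L2 n π.K where
  toFun ψ := (memLp_fibre π k ψ).toLp _
  map_add' ψ χ := by
    apply Lp.ext
    filter_upwards [(memLp_fibre π k (ψ + χ)).coeFn_toLp, (memLp_fibre π k ψ).coeFn_toLp,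
      (memLp_fibre π k χ).coeFn_toLp, Lp.coeFn_add ψ χ,
      Lp.coeFn_add ((memLp_fibre π k ψ).toLp _) ((memLp_fibre π k χ).toLp _)] with x h1 h2 h3 h4 h5
    rw [h1, h5, Pi.add_apply, h2, h3, h4, Pi.add_apply, map_add, smul_add]
  map_smul' c ψ := by
    apply Lp.ext
    filter_upwards [(memLp_fibre π k (c • ψ)).coeFn_toLp, (memLp_fibre π k ψ).coeFn_toLp,
      Lp.coeFn_smul c ψ, Lp.coeFn_smul c ((memLp_fibre π k ψ).toLp _)] with x h1 h2 h3 h4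
    rw [h1, RingHom.id_apply, h4, Pi.smul_apply, h2, h3, Pi.smul_apply, map_smul, smul_comm]
  norm_map' ψ := by
    change ‖(memLp_fibre π k ψ).toLp _‖ = ‖ψ‖
    rw [Lp.norm_toLp, Lp.norm_def]
    congr 1
    apply eLpNorm_congr_norm_ae
    exact Eventually.of_forall fun x => by simp [norm_smul, norm_phase]

theorem coeFn_fibre (k : Pt (n + 1)) (ψ : L2 n π.K) :
    fibre π k ψ =ᵐ[volume] fun x => phase k x • π.W (slot k) (ψ x) :=
  (memLp_fibre π k ψ).coeFn_toLp

theorem mp_add (s : Pt n) : MeasurePreserving (fun x : Pt n => x + s) volume volume :=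
  measurePreserving_add_right volume s

/-- `(e^{i ∑ k_j q_j} ψ)(x) = e^{i k x} π(e^{i k_0 q}) ψ(x - ½ k σ)`. -/
def indW (k : Pt (n + 1)) : L2 n π.K →ₗᵢ[ℂ] L2 n π.K :=
  (fibre π k).comp (Lp.compMeasurePreservingₗᵢ ℂ (fun x : Pt n => x + shift σ k) (mp_add _))

theorem coeFn_indW (k : Pt (n + 1)) (ψ : L2 n π.K) :
    indW π k ψ =ᵐ[volume] fun x => phase k x • π.W (slot k) (ψ (x + shift σ k)) := by
  have h := Lp.coeFn_compMeasurePreserving ψ (mp_add (shift σ k))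
  filter_upwards [coeFn_fibre π k (Lp.compMeasurePreserving _ (mp_add (shift σ k)) ψ), h]
    with x h1 h2
  change (fibre π k (Lp.compMeasurePreserving _ (mp_add (shift σ k)) ψ)) x = _
  rw [h1, h2]; rfl

theorem continuous_fibre (ψ : L2 n π.K) : Continuous fun k => fibre π k ψ := by
  rw [continuous_iff_continuousAt]
  intro k₀
  refine (Lp.tendsto_Lp_iff_tendsto_eLpNorm' _ _).2 ?_
  have key : ∀ k, eLpNorm (⇑(fibre π k ψ) - ⇑(fibre π k₀ ψ)) 2 volume =
      (∫⁻ x, ‖phase k x • π.W (slot k) (ψ x) - phase k₀ x • π.W (slot k₀) (ψ x)‖ₑ ^ (2 : ℝ))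
        ^ (1 / (2 : ℝ)) := by
    intro k
    rw [eLpNorm_congr_ae ((coeFn_fibre π k ψ).sub (coeFn_fibre π k₀ ψ)),
      eLpNorm_eq_lintegral_rpow_enorm_toReal (by norm_num) (by norm_num)]
    simp
  simp_rw [key]
  have h0 : Tendsto (fun k => ∫⁻ x, ‖phase k x • π.W (slot k) (ψ x)
      - phase k₀ x • π.W (slot k₀) (ψ x)‖ₑ ^ (2 : ℝ)) (𝓝 k₀) (𝓝 (∫⁻ _ : Pt n, 0)) := by
    refine tendsto_lintegral_filter_of_dominated_convergence'
      (fun x => (2 * ‖ψ x‖ₑ) ^ (2 : ℝ)) ?_ ?_ ?_ ?_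
    · refine Eventually.of_forall fun k => ?_
      exact (((memLp_fibre π k ψ).1.sub (memLp_fibre π k₀ ψ).1).enorm).pow_const _
    · refine Eventually.of_forall fun k => Eventually.of_forall fun x => ?_
      gcongr
      refine (enorm_sub_le).trans (le_of_eq ?_)
      rw [two_mul]
      congr 1 <;>
      · rw [← ofReal_norm, norm_smul, norm_phase, one_mul, LinearIsometry.norm_map, ofReal_norm]
    · simp_rw [ENNReal.mul_rpow_of_nonneg _ _ (show (0 : ℝ) ≤ 2 by norm_num)]
      rw [lintegral_const_mul' _ _ (by finiteness)]
      refine ENNReal.mul_ne_top (by finiteness) ?_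
      have := (Lp.memLp ψ).2
      have h3 := lintegral_rpow_enorm_lt_top_of_eLpNorm_lt_top (by norm_num) (by norm_num) this
      simpa using h3.ne
    · refine Eventually.of_forall fun x => ?_
      have hc : Continuous fun k : Pt (n + 1) => phase k x • π.W (slot k) (ψ x)
          - phase k₀ x • π.W (slot k₀) (ψ x) := by
        refine Continuous.sub (Continuous.smul ?_ ?_) continuous_const
        · exact continuous_phase.comp (Continuous.prodMk_left x)
        · exact (π.W_cont _).comp continuous_slot
      have := (hc.enorm.tendsto k₀)
      have h4 := (ENNReal.continuous_rpow_const (y := (2 : ℝ))).tendsto _ |>.comp this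
      simpa [Function.comp_def] using h4
  have h1 := (ENNReal.continuous_rpow_const (y := (1 / 2 : ℝ))).tendsto _ |>.comp h0
  simpa [Function.comp_def] using h1

theorem continuous_indW (ψ : L2 n π.K) : Continuous fun k => indW π k ψ := by
  have hτ : Continuous fun k : Pt (n + 1) =>
      Lp.compMeasurePreserving (fun x : Pt n => x + shift σ k) (mp_add _) ψ := by
    have h := Continuous.compMeasurePreservingLp (X := Pt n) (Y := Pt n) (p := 2) (E := π.K)
      (μ := volume) (ν := volume)
      (g := fun k : Pt (n + 1) => (⟨fun x => x + shift σ k, by fun_prop⟩ : C(Pt n, Pt n)))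
      (f := fun _ => ψ) continuous_const ?_ (fun k => mp_add _) (by norm_num)
    · exact h
    · refine ContinuousMap.continuous_of_continuous_uncurry _ ?_
      exact continuous_snd.add ((continuous_shift σ).comp continuous_fst)
  rw [continuous_iff_continuousAt]
  intro k₀
  set ψ₀ := Lp.compMeasurePreserving (fun x : Pt n => x + shift σ k₀) (mp_add _) ψ with hψ
  have h1 : Tendsto (fun k => fibre π k (Lp.compMeasurePreserving (fun x : Pt n => x + shift σ k)
      (mp_add _) ψ - ψ₀)) (𝓝 k₀) (𝓝 0) := by
    rw [tendsto_zero_iff_norm_tendsto_zero]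
    simp only [LinearIsometry.norm_map]
    have := (hτ.tendsto k₀).sub_const ψ₀
    rw [sub_self] at this
    exact tendsto_zero_iff_norm_tendsto_zero.1 this
  have h2 := h1.add ((continuous_fibre π ψ₀).tendsto k₀)
  rw [zero_add] at h2
  refine h2.congr fun k => ?_
  rw [← map_add, sub_add_cancel]
  rfl

theorem phase_slot_mul (k h : Pt (n + 1)) (x : Pt n) :
    phase k x * phase h (x + shift σ k) *
      Complex.exp (-(Complex.I / 2) * (twist σ (slot k) (slot h) : ℂ)) =
    Complex.exp (-(Complex.I / 2) * (twist σ k h : ℂ)) * phase (k + h) x := by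
  have h1 : ∑ j, ∑ μ, h j.succ μ * shift σ k j μ =
      -(1 / 2) * ∑ j : Fin n, ∑ μ, ∑ ν, k j.succ μ * h j.succ ν * σ μ ν := by
    simp only [shift, Finset.mul_sum]
    refine Finset.sum_congr rfl fun j _ => ?_
    rw [Finset.sum_comm]
    refine Finset.sum_congr rfl fun μ _ => Finset.sum_congr rfl fun ν _ => ?_
    ring
  have h2 : twist σ k h = twist σ (slot k) (slot h) +
      ∑ j : Fin n, ∑ μ, ∑ ν, k j.succ μ * h j.succ ν * σ μ ν := by
    simp [twist, Fin.sum_univ_succ (n := n), slot]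
  unfold phase
  rw [h2]
  simp only [Pi.add_apply, mul_add, add_mul, Finset.sum_add_distrib, ← Complex.exp_add, h1]
  congr 1
  push_cast
  ring

/-- The representation of `n + 1` coordinates on `L²(ℝ^{4n}; K)` built from `π`. -/
def indRep (n : ℕ) : WeylRep (n + 1) σ where
  K := L2 n π.K
  W := indW π
  W_zero := by
    ext1 ψ
    apply Lp.ext
    filter_upwards [coeFn_indW π 0 ψ] with x hx
    have e1 : slot (0 : Pt (n + 1)) = 0 := rfl
    have e2 : shift σ (0 : Pt (n + 1)) = 0 := by ext; simp [shift]
    rw [hx, e1, e2, π.W_zero]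
    simp [phase]
  W_mul k h ψ := by
    apply Lp.ext
    have hq := (mp_add (shift σ k)).quasiMeasurePreserving.ae (coeFn_indW π h ψ)
    filter_upwards [coeFn_indW π k (indW π h ψ), hq, coeFn_indW π (k + h) ψ,
      Lp.coeFn_smul (Complex.exp (-(Complex.I / 2) * (twist σ k h : ℂ))) (indW π (k + h) ψ)]
      with x h1 h2 h3 h4
    have e1 : shift σ (k + h) = shift σ k + shift σ h := by
      ext j ν; simp only [shift, Pi.add_apply, add_mul, Finset.sum_add_distrib]; ring
    rw [h1, h2, h4, Pi.smul_apply, h3, map_smul, π.W_mul, smul_smul, smul_smul, smul_smul,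
      phase_slot_mul, e1, add_assoc]
    rfl
  W_cont := continuous_indW π
end
theorem sum_mul_shift {σ : Matrix (Fin 4) (Fin 4) ℝ} (h : σᵀ = -σ) (k : Pt (n + 1)) (j : Fin n) :
    ∑ μ, k j.succ μ * shift σ k j μ = 0 := by
  have hs : ∀ μ ν, σ ν μ = -σ μ ν := fun μ ν => congrFun (congrFun h μ) ν
  have e : ∑ μ, k j.succ μ * shift σ k j μ =
      -(1 / 2) * ∑ μ, ∑ ν, k j.succ μ * k j.succ ν * σ ν μ := by
    simp only [shift, Finset.mul_sum]
    exact Finset.sum_congr rfl fun μ _ => Finset.sum_congr rfl fun ν _ => by ring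
  have e2 : ∑ μ, ∑ ν, k j.succ μ * k j.succ ν * σ ν μ =
      -∑ μ, ∑ ν, k j.succ μ * k j.succ ν * σ ν μ := by
    conv_lhs => rw [Finset.sum_comm]
    rw [← Finset.sum_neg_distrib]
    refine Finset.sum_congr rfl fun μ _ => ?_
    rw [← Finset.sum_neg_distrib]
    refine Finset.sum_congr rfl fun ν _ => ?_
    rw [hs ν μ]; ring
  rw [e]; linarith

theorem sum_shift_sq {σ : Matrix (Fin 4) (Fin 4) ℝ} (h : σ * σᵀ = 1) (k : Pt (n + 1)) (j : Fin n) :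
    ∑ μ, shift σ k j μ ^ 2 = 1 / 4 * ∑ μ, k j.succ μ ^ 2 := by
  have e : ∀ μ, shift σ k j μ = -(1 / 2) * (k j.succ ᵥ* σ) μ := fun μ => rfl
  have e2 : (k j.succ ᵥ* σ) ⬝ᵥ (k j.succ ᵥ* σ) = k j.succ ⬝ᵥ k j.succ := by
    conv_lhs => rw [← Matrix.mulVec_transpose, Matrix.dotProduct_mulVec, Matrix.mulVec_transpose,
      Matrix.vecMul_vecMul, h, Matrix.vecMul_one]
  simp only [dotProduct, ← sq] at e2
  simp only [e, mul_pow, ← Finset.mul_sum, e2]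
  norm_num

/-- The parameter `a = 2 + √3`, a root of `a / 8 + 1 / (8 a) = 1 / 2`: with it the vector state of
the Gaussian `exp(-a |x|²)` takes the value `exp(-½ |k|²)` on plane waves, for `σ ∈ Σ₁`. -/
def width : ℝ := 2 + √3

theorem width_pos : 0 < width := by unfold width; positivity

theorem width_eq : width ^ 2 - 4 * width + 1 = 0 := by
  unfold width; ring_nf; rw [Real.sq_sqrt (by norm_num)]; norm_num

/-- The normalized Gaussian on `ℝ^{4n}`. -/
def gaussian (n : ℕ) (x : Pt n) : ℂ :=
  ((2 * width / Real.pi) ^ n * Real.exp (-width * ∑ j, ∑ μ, x j μ ^ 2) : ℝ)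

theorem gaussian_eq_prod (x : Pt n) : gaussian n x =
    ((2 * width / Real.pi) ^ n : ℝ) * ∏ j, ∏ μ, Complex.exp (-width * (x j μ : ℂ) ^ 2) := by
  unfold gaussian
  push_cast
  simp only [← Complex.exp_sum, ← Finset.mul_sum]

theorem gaussian_integral {σ : Matrix (Fin 4) (Fin 4) ℝ} (hσ : σ ∈ SigOne) (k : Pt (n + 1)) :
    ∫ x, gaussian n x * phase k x * gaussian n (x + shift σ k) =
      ∏ j : Fin n, (locWeyl (k j.succ) : ℂ) := by
  have hw := width_pos
  set a : ℂ := (width : ℂ) with ha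
  have ha0 : a ≠ 0 := by rw [ha]; exact_mod_cast hw.ne'
  set s := shift σ k with hs
  have e1 : ∀ x : Pt n, gaussian n x * phase k x * gaussian n (x + s) =
      ((2 * width / Real.pi) ^ n : ℝ) ^ 2 * ∏ j, ∏ μ, Complex.exp (-(2 * a) * (x j μ : ℂ) ^ 2 +
        (Complex.I * k j.succ μ - 2 * a * s j μ) * x j μ + -a * (s j μ : ℂ) ^ 2) := by
    intro x
    rw [gaussian_eq_prod, gaussian_eq_prod]
    unfold phase
    simp only [← Complex.exp_sum]
    rw [show ∀ c p q r : ℂ, c * Complex.exp p * Complex.exp q * (c * Complex.exp r)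
      = c ^ 2 * Complex.exp (p + q + r) from fun c p q r => by
        rw [Complex.exp_add, Complex.exp_add]; ring]
    congr 2
    push_cast
    rw [Finset.mul_sum, ← Finset.sum_add_distrib, ← Finset.sum_add_distrib]
    refine Finset.sum_congr rfl fun j _ => ?_
    rw [Finset.mul_sum, ← Finset.sum_add_distrib, ← Finset.sum_add_distrib]
    refine Finset.sum_congr rfl fun μ _ => ?_
    simp only [Pi.add_apply]
    push_cast
    ring
  simp_rw [e1]
  rw [integral_const_mul,
    integral_fintype_prod_volume_eq_prod (f := fun j (y : Fin 4 → ℝ) =>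
      ∏ μ, Complex.exp (-(2 * a) * (y μ : ℂ) ^ 2 +
        (Complex.I * k (Fin.succ j) μ - 2 * a * s j μ) * y μ + -a * (s j μ : ℂ) ^ 2))]
  have e2 : ∀ j : Fin n, ∫ y : Fin 4 → ℝ, ∏ μ, Complex.exp (-(2 * a) * (y μ : ℂ) ^ 2 +
        (Complex.I * k (Fin.succ j) μ - 2 * a * s j μ) * y μ + -a * (s j μ : ℂ) ^ 2) =
      (Real.pi / (2 * a)) ^ 2 * locWeyl (k j.succ) := by
    intro j
    rw [integral_fintype_prod_volume_eq_prod (f := fun μ (y : ℝ) =>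
      Complex.exp (-(2 * a) * (y : ℂ) ^ 2 +
        (Complex.I * k (Fin.succ j) μ - 2 * a * s j μ) * y + -a * (s j μ : ℂ) ^ 2))]
    have hre : (-(2 * a)).re < 0 := by rw [ha]; simpa using hw
    simp_rw [integral_cexp_quadratic hre]
    rw [Finset.prod_mul_distrib, Finset.prod_const, ← Complex.cpow_nat_mul, ← Complex.exp_sum]
    congr 1
    · simp only [neg_neg, Finset.card_univ, Fintype.card_fin]
      norm_num
    · unfold locWeyl
      push_cast
      congr 1
      have h1 : ∑ μ, (k j.succ μ : ℂ) * s j μ = 0 := by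
        exact_mod_cast sum_mul_shift (SigOne_antisymm hσ) k j
      have h2 : ∑ μ, (s j μ : ℂ) ^ 2 = 1 / 4 * ∑ μ, (k j.succ μ : ℂ) ^ 2 := by
        have := sum_shift_sq (SigOne_orthogonal hσ) k j
        rw [← hs] at this
        have h6 := congrArg (fun r : ℝ => (r : ℂ)) this
        push_cast at h6
        exact h6
      have h3 : a ^ 2 - 4 * a + 1 = 0 := by rw [ha]; exact_mod_cast width_eq
      have h4 : ∀ μ, -a * (s j μ : ℂ) ^ 2 - (Complex.I * k j.succ μ - 2 * a * s j μ) ^ 2 /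
          (4 * -(2 * a)) = -(a / 2) * (s j μ : ℂ) ^ 2 - 1 / (8 * a) * (k j.succ μ : ℂ) ^ 2
            - Complex.I / 2 * (k j.succ μ * s j μ) := by
        intro μ
        field_simp
        ring_nf
        rw [Complex.I_sq]
        ring
      simp only [h4, Finset.sum_sub_distrib, ← Finset.mul_sum, h1, h2]
      have h5 : a / 8 + 1 / (8 * a) = 1 / 2 := by
        field_simp
        linear_combination 2 * h3
      linear_combination (-(∑ μ, (k j.succ μ : ℂ) ^ 2)) * h5
  simp_rw [e2]
  rw [Finset.prod_mul_distrib, Finset.prod_const, ← mul_assoc]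
  have hpi : (Real.pi : ℂ) ≠ 0 := by exact_mod_cast Real.pi_ne_zero
  have : (((2 * width / Real.pi) ^ n : ℝ) : ℂ) ^ 2 * ((Real.pi / (2 * a)) ^ 2) ^ (Finset.univ : Finset (Fin n)).card = 1 := by
    rw [Finset.card_univ, Fintype.card_fin]
    push_cast
    rw [← ha, ← pow_mul, ← pow_mul, mul_comm n 2, ← mul_pow]
    have : 2 * a / Real.pi * (Real.pi / (2 * a)) = 1 := by field_simp
    rw [this, one_pow]
  rw [this, one_mul]

theorem memLp_gaussian (n : ℕ) : MemLp (gaussian n) 2 (volume : Measure (Pt n)) := by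
  have hc : Continuous (gaussian n) := by unfold gaussian; fun_prop
  refine (memLp_two_iff_integrable_sq_norm hc.aestronglyMeasurable).2 ?_
  have h1 : Integrable (fun x : Pt n => ((2 * width / Real.pi) ^ n : ℝ) ^ 2 *
      ∏ j, ∏ μ, Real.exp (-(2 * width) * x j μ ^ 2)) := by
    refine Integrable.const_mul ?_ _
    refine Integrable.fintype_prod (f := fun _ (y : Fin 4 → ℝ) =>
      ∏ μ, Real.exp (-(2 * width) * y μ ^ 2)) fun _ => ?_
    exact Integrable.fintype_prod (f := fun _ (y : ℝ) => Real.exp (-(2 * width) * y ^ 2))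
      fun _ => integrable_exp_neg_mul_sq (by have := width_pos; positivity)
  refine h1.congr (Eventually.of_forall fun x => ?_)
  simp only [gaussian, Complex.norm_real, Real.norm_eq_abs, sq_abs, mul_pow, ← Real.exp_sum,
    ← Finset.mul_sum]
  rw [← Real.exp_nat_mul]
  congr 2
  push_cast; ring

section Dilation
variable (π : WeylRep 1 σ)

theorem memLp_smul_gaussian (n : ℕ) (v : π.K) :
    MemLp (fun x => gaussian n x • v) 2 (volume : Measure (Pt n)) := by
  have hc : Continuous (gaussian n) := by unfold gaussian; fun_prop
  refine ((memLp_gaussian n).norm.const_mul ‖v‖).of_le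
    (hc.smul continuous_const).aestronglyMeasurable (Eventually.of_forall fun x => ?_)
  simp [norm_smul, mul_comm]

theorem inner_dilation (hσ : σ ∈ SigOne) (k : Pt (n + 1)) (v w : π.K) :
    ⟪(memLp_smul_gaussian π n v).toLp _, indW π k ((memLp_smul_gaussian π n w).toLp _)⟫_ℂ =
      (∏ j : Fin n, (locWeyl (k j.succ) : ℂ)) * ⟪v, π.W (slot k) w⟫_ℂ := by
  rw [L2.inner_def, ← gaussian_integral hσ k, ← integral_mul_const]
  refine integral_congr_ae ?_
  have hq := (mp_add (shift σ k)).quasiMeasurePreserving.ae (memLp_smul_gaussian π n w).coeFn_toLp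
  filter_upwards [(memLp_smul_gaussian π n v).coeFn_toLp,
    coeFn_indW π k ((memLp_smul_gaussian π n w).toLp _), hq] with x h1 h2 h3
  rw [h1, h2, h3, map_smul, inner_smul_left, inner_smul_right, inner_smul_right]
  have : (starRingEnd ℂ) (gaussian n x) = gaussian n x := Complex.conj_ofReal _
  rw [this]
  ring

/-- The isometry `v ↦ Ω ⊗ v`, with `Ω` the normalized Gaussian. -/
def locIsometry (n : ℕ) (hσ : σ ∈ SigOne) : π.K →ₗᵢ[ℂ] L2 n π.K where
  toFun v := (memLp_smul_gaussian π n v).toLp _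
  map_add' v w := by
    rw [← MemLp.toLp_add]
    exact MemLp.toLp_congr _ _ (Eventually.of_forall fun x => smul_add _ _ _)
  map_smul' c v := by
    rw [RingHom.id_apply, ← MemLp.toLp_const_smul]
    exact MemLp.toLp_congr _ _ (Eventually.of_forall fun x => smul_comm _ _ _)
  norm_map' v := by
    change ‖(memLp_smul_gaussian π n v).toLp _‖ = ‖v‖
    have h := inner_dilation π hσ (0 : Pt (n + 1)) v v
    have e0 : indW π (0 : Pt (n + 1)) = LinearIsometry.id := (indRep π n).W_zero
    have e1 : slot (0 : Pt (n + 1)) = 0 := rfl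
    have e2 : ∀ j : Fin n, (locWeyl ((0 : Pt (n + 1)) j.succ) : ℂ) = 1 := fun j => by
      simp [locWeyl]
    rw [e0, e1, π.W_zero] at h
    simp only [LinearIsometry.id_apply, inner_self_eq_norm_sq_to_K, e2, Finset.prod_const_one,
      one_mul] at h
    have h' : ‖(memLp_smul_gaussian π n v).toLp _‖ ^ 2 = ‖v‖ ^ 2 := by exact_mod_cast h
    exact (sq_eq_sq₀ (norm_nonneg _) (norm_nonneg _)).1 h'

/-- The dilation of `π ⊗ η ⊗ ⋯ ⊗ η`. -/
def locDilation (n : ℕ) (hσ : σ ∈ SigOne) : LocDilation n π where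
  rep := indRep π n
  V := locIsometry π n hσ
  inner_W k v w := inner_dilation π hσ k v w

end Dilation

/-- The map `γ ⊗_Z η ⊗_Z ⋯ ⊗_Z η` (`n` factors `η`), on multipliers of `ℰ^{(n+1)}`: the normal slice
map which restricts to `Σ₁` and sends `e^{i(k_0 q_0 + ⋯ + k_n q_n)}` to
`e^{i k_0 q} ∏_{j=1}^n ⟨η, e^{i k_j q}⟩`. -/
def slice (n : ℕ) : Sections Sig (n + 1) →ₗ[ℂ] Sections SigOne 1 where
  toFun A := Sections.mk
    (fun π =>
      let D := locDilation π.2 n π.1.2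
      D.V.toContinuousLinearMap.adjoint ∘L
        A.eval ⟨⟨π.1, SigOne_subset_Sig π.1.2⟩, D.rep⟩ ∘L D.V.toContinuousLinearMap)
    ‖A‖ fun π => by
      have hV := (locDilation π.2 n π.1.2).V.norm_toContinuousLinearMap_le
      refine (ContinuousLinearMap.opNorm_comp_le _ _).trans ?_
      rw [LinearIsometryEquiv.norm_map]
      refine (mul_le_of_le_one_left (norm_nonneg _) hV).trans ?_
      refine (ContinuousLinearMap.opNorm_comp_le _ _).trans ?_
      exact (mul_le_of_le_one_right (norm_nonneg _) hV).trans (A.norm_eval_le _)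
  map_add' A B := Sections.ext fun π => by
    let D := locDilation π.2 n π.1.2
    refine ContinuousLinearMap.ext fun v => ?_
    exact map_add (D.V.toContinuousLinearMap.adjoint)
      (A.eval ⟨⟨π.1, SigOne_subset_Sig π.1.2⟩, D.rep⟩ (D.V v))
      (B.eval ⟨⟨π.1, SigOne_subset_Sig π.1.2⟩, D.rep⟩ (D.V v))
  map_smul' c A := Sections.ext fun π => by
    let D := locDilation π.2 n π.1.2
    refine ContinuousLinearMap.ext fun v => ?_
    exact map_smul (D.V.toContinuousLinearMap.adjoint) c
      (A.eval ⟨⟨π.1, SigOne_subset_Sig π.1.2⟩, D.rep⟩ (D.V v))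

/-- The quantum diagonal map `E^{(n)} = (γ ⊗_Z η ⊗_Z ⋯ ⊗_Z η) ∘ β^{(n)}`, extended to `M(ℰ^{(n)})`. -/
def quantumDiagonalMap (n : ℕ) : multiplierAlgebra Sig n →ₗ[ℂ] Sections SigOne 1 where
  toFun A := slice n (beta n A)
  map_add' A B := by
    rw [← map_add, ← map_add]; rfl
  map_smul' c A := by
    rw [RingHom.id_apply, ← map_smul, ← map_smul]; rfl

/-! ### Symbols, kernels -/

/-- `f̌ = fc` is the inverse Fourier transform of `f` on `ℝ^{4n}` and is integrable, i.e.
`f(x) = ∫ dk f̌(k) e^{ikx}`. -/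
def HasCheck (f : Pt n → ℂ) (fc : Pt n → ℂ) : Prop :=
  Integrable fc ∧
    ∀ x, f x = ∫ k, fc k * Complex.exp (Complex.I * (∑ j, ∑ μ, k j μ * x j μ : ℝ))

/-- The same on `ℝ⁴`. -/
def HasCheck₄ (h : (Fin 4 → ℝ) → ℂ) (hc : (Fin 4 → ℝ) → ℂ) : Prop :=
  Integrable hc ∧ ∀ x, h x = ∫ k, hc k * Complex.exp (Complex.I * (∑ μ, k μ * x μ : ℝ))

/-- The momentum `k / √n` of the coordinate `q` in `e^{ikq̃}`, where `q̃ = q / √n`. -/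
def tildeMomentum (n : ℕ) : C(Fin 4 → ℝ, Pt 1) where
  toFun k := fun _ => (√n)⁻¹ • k
  continuous_toFun := by fun_prop

/-- The map `(k_1, …, k_n) ↦ ∑_j k_j`. -/
def totalMomentum (n : ℕ) : C(Pt n, Fin 4 → ℝ) where
  toFun k := ∑ j, k j
  continuous_toFun := by fun_prop

/-- `h(q̃) = ∫ dk ȟ(k) e^{ikq̃}` in `M(ℰ₁)`, where `φ = ȟ`. -/
def ofTilde (n : ℕ) (φ : (Fin 4 → ℝ) → ℂ) : Sections SigOne 1 :=
  quantize 1 (tildeMomentum n) φ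

/-- The kernel `r_n`. -/
def rKernel (n : ℕ) (k : Pt n) : ℝ :=
  Real.exp (-(1 / 2) * ∑ μ, (∑ j, k j μ ^ 2 - 1 / (n : ℝ) * ∑ j, ∑ l, k j μ * k l μ))

/-- The measure `δ⁽⁴⁾(n⁻¹ ∑_j a_j) da_1 ⋯ da_n` on `ℝ^{4n}`: integrating out `a_n = n y - ∑_{j<n} a_j`,
`da_n = n⁴ dy`, at `y = 0` gives `n⁴ da_1 ⋯ da_{n-1}` on the subspace `∑_j a_j = 0`. -/
def deltaMean : (n : ℕ) → Measure (Pt n)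
  | 0 => 0
  | n + 1 => ((n + 1 : ℕ) : ℝ≥0∞) ^ 4 •
      Measure.map (fun b : Pt n => (Fin.snoc b (-∑ j, b j) : Pt (n + 1))) volume

/-- The normalization constant `c_n = n⁻² (2π)^{-2(n-1)}`. -/
def cConst (n : ℕ) : ℝ := ((n : ℝ) ^ 2 * (2 * Real.pi) ^ (2 * (n - 1)))⁻¹

/-- `A = ∫ dk Ȟ(σ, k) e^{ikq̃}` at every `σ ∈ Σ₁`: the symbol of `A`, as a function of `q̃`, at `σ` has
inverse Fourier transform `Hc σ`. -/
def HasSymbol (n : ℕ) (A : Sections SigOne 1) (Hc : SigOne → (Fin 4 → ℝ) → ℂ) : Prop :=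
  (∀ σ, Integrable (Hc σ)) ∧ ∀ π : Rep SigOne 1, A.eval π = π.2.smear (tildeMomentum n) (Hc π.1)

end QuantumSpacetime
end

open QuantumSpacetime

/-!
Evaluated in a regular representation `π` over `Σ₁`, the quantum diagonal map compresses
`∫ dk f̌(k) W(meanSplit k)` by the isometry of the dilation of `π ⊗ η ⊗ ⋯ ⊗ η`. The compression may
be taken under the integral sign, where each plane wave goes to the product of the Gaussian factors
`⟨η, e^{ipq}⟩` over the difference momenta `p = k_j - n⁻¹ ∑_l k_l`, which is `r_n(k)`, times the
plane wave of the mean coordinate (`quantumDiagonalMap_ofCoordinates`). This is the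
momentum-space formula.

The plane waves that remain depend on `k` only through `∑_j k_j`. Disintegrating Lebesgue measure on
`ℝ^{4n}` along this sum, by a measure preserving shear (`measurePreserving_withSum`), gives
`E^{(n)}(f) = h(q̃)` with `ȟ` the density of the image of `f̌ r_n dk` (`quantize_totalMomentum`). This
`ȟ` is integrable, so `h` is in `C₀` by the Riemann–Lebesgue lemma. It does not involve `σ`, and since
`Σ₁` is compact, `h(q̃)` lies in `ℰ₁` itself and not only in its multiplier algebra
(`ofTilde_mem_symbolAlgebra`).

For the position-space formula, Fubini reduces the claim to the Fourier transform of the Gaussian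
on the hyperplane `∑_j a_j = 0`, with the measure `da_1 ⋯ da_{n-1}`, being `c_n⁻¹ n⁻⁴ r_n`. No
determinant has to be computed: the same
shear splits the full Gaussian integral on `ℝ^{4n}` into the hyperplane integral and a Gaussian
integral over the sum, and both the full integral and the latter are products of one-dimensional
ones (`integral_planeWave_withSum_zero`).
-/

noncomputable section
namespace QuantumSpacetime

variable {m n : ℕ} {σ : Matrix (Fin 4) (Fin 4) ℝ}

/-! ### The kernel `r_n` and the diagonal map on plane waves -/

theorem prod_locWeyl_meanSplit (hn : n ≠ 0) (k : Pt n) :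
    ∏ j : Fin n, locWeyl (meanSplit n k j.succ) = rKernel n k := by
  have hn' : (n : ℝ) ≠ 0 := Nat.cast_ne_zero.2 hn
  unfold locWeyl rKernel
  rw [← Real.exp_sum, ← Finset.mul_sum, Finset.sum_comm]
  congr 2
  refine Finset.sum_congr rfl fun μ _ => ?_
  simp only [meanSplit, ContinuousMap.coe_mk, Fin.cons_succ, Pi.sub_apply, Pi.smul_apply,
    Finset.sum_apply, smul_eq_mul, ← Finset.mul_sum, ← Finset.sum_mul]
  set X := ∑ l, k l μ with hX
  have e : ∀ j, (k j μ - (n : ℝ)⁻¹ * X) ^ 2 =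
      k j μ ^ 2 - 2 * (n : ℝ)⁻¹ * X * k j μ + ((n : ℝ)⁻¹ * X) ^ 2 := fun j => by ring
  simp only [e, Finset.sum_add_distrib, Finset.sum_sub_distrib, ← Finset.mul_sum,
    Finset.sum_const, Finset.card_univ, Fintype.card_fin, nsmul_eq_mul, ← hX]
  field_simp
  ring

theorem continuous_rKernel (n : ℕ) : Continuous (rKernel n) := by
  unfold rKernel; fun_prop

theorem rKernel_le_one (hn : n ≠ 0) (k : Pt n) : rKernel n k ≤ 1 := by
  rw [← prod_locWeyl_meanSplit hn]
  refine Finset.prod_le_one (fun j _ => (Real.exp_pos _).le) fun j _ => ?_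
  refine Real.exp_le_one_iff.2 ?_
  have : 0 ≤ ∑ μ, meanSplit n k j.succ μ ^ 2 := Finset.sum_nonneg fun μ _ => sq_nonneg _
  linarith

theorem integrable_mul_rKernel (hn : n ≠ 0) {φ : Pt n → ℂ} (hφ : Integrable φ) :
    Integrable fun k => φ k * (rKernel n k : ℂ) := by
  refine hφ.mul_bdd (c := 1)
    (Complex.continuous_ofReal.comp (continuous_rKernel n)).aestronglyMeasurable
    (Eventually.of_forall fun k => ?_)
  rw [Complex.norm_real, Real.norm_of_nonneg (by unfold rKernel; positivity)]
  exact rKernel_le_one hn k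

section Smear
variable {X : Type} [TopologicalSpace X] [SecondCountableTopology X] [MeasureSpace X] [BorelSpace X]

theorem WeylRep.smear_apply (π : WeylRep m σ) (u : C(X, Pt m)) {φ : X → ℂ}
    (hφ : Integrable φ) (v : π.K) : π.smear u φ v = ∫ x, φ x • π.W (u x) v := by
  unfold WeylRep.smear
  rw [dif_pos hφ]
  rfl

theorem eval_quantize_one {S : Set (Matrix (Fin 4) (Fin 4) ℝ)} (u : C(X, Pt m)) (φ : X → ℂ)
    (π : Rep S m) : (quantize (1 : S →ᵇ ℂ) u φ).eval π = π.2.smear u φ := by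
  rw [quantize, Sections.eval_mk]
  exact one_smul _ _
end Smear

/-- Matrix elements of `E^{(n)}(f(q_1, …, q_n))` are those of the dilation, where the `k`-integral
of plane waves may be evaluated under the integral sign: the `η`-factors multiply to `r_n`, and the
mean coordinate carries the momentum `n^{-1/2} ∑_j k_j`. -/
theorem quantumDiagonalMap_ofCoordinates (hn : n ≠ 0) {φ : Pt n → ℂ} (hφ : Integrable φ) :
    quantumDiagonalMap n (ofCoordinates n φ) =
      quantize 1 ((tildeMomentum n).comp (totalMomentum n)) fun k => φ k * (rKernel n k : ℂ) := by
  refine Sections.ext fun π => ?_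
  rw [eval_quantize_one]
  set D := locDilation π.2 n π.1.2 with hD
  have hL : (quantumDiagonalMap n (ofCoordinates n φ)).eval π =
      D.V.toContinuousLinearMap.adjoint ∘L
        (D.rep.boldRep.smear (ContinuousMap.id _) φ) ∘L D.V.toContinuousLinearMap := by
    rw [← eval_quantize_one (S := Sig) (ContinuousMap.id _) φ
      ⟨⟨π.1, SigOne_subset_Sig π.1.2⟩, D.rep.boldRep⟩]
    rfl
  rw [hL]
  refine ContinuousLinearMap.ext fun w => ext_inner_left ℂ fun v => ?_
  rw [WeylRep.smear_apply _ _ (integrable_mul_rKernel hn hφ)]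
  rw [ContinuousLinearMap.comp_apply, ContinuousLinearMap.comp_apply,
    ContinuousLinearMap.adjoint_inner_right]
  rw [WeylRep.smear_apply (D.rep.boldRep) _ hφ]
  rw [← integral_inner (𝕜 := ℂ) (D.rep.boldRep.integrable_smul (ContinuousMap.id _) hφ _),
    ← integral_inner (𝕜 := ℂ) (π.2.integrable_smul _ (integrable_mul_rKernel hn hφ) _)]
  refine integral_congr_ae (Eventually.of_forall fun k => ?_)
  have h := D.inner_W (meanSplit n k) v w
  rw [← Complex.ofReal_prod, prod_locWeyl_meanSplit hn] at h
  simp only [inner_smul_right, mul_assoc]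
  congr 1

/-! ### Disintegration of `ℝ^{4n}` over the sum of the coordinates -/

/-- The point of `ℝ^{4(m+1)}` whose first `m` coordinates are `b` and whose coordinates sum
to `s`. -/
def withSum (s : Fin 4 → ℝ) (b : Pt m) : Pt (m + 1) := Fin.snoc b (s - ∑ j, b j)

theorem withSum_castSucc (s : Fin 4 → ℝ) (b : Pt m) (j : Fin m) :
    withSum s b j.castSucc = b j := by
  simp [withSum]

theorem withSum_last (s : Fin 4 → ℝ) (b : Pt m) :
    withSum s b (Fin.last m) = s - ∑ j, b j := by
  simp [withSum]

theorem sum_withSum (s : Fin 4 → ℝ) (b : Pt m) : ∑ j, withSum s b j = s := by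
  simp [Fin.sum_univ_castSucc, withSum_castSucc, withSum_last]

theorem measurePreserving_withSum (m : ℕ) :
    MeasurePreserving (fun p : (Fin 4 → ℝ) × Pt m => withSum p.1 p.2) := by
  have h1 := (volume_preserving_piFinSuccAbove (fun _ : Fin (m + 1) => Fin 4 → ℝ)
    (Fin.last m)).symm
  have h2 : MeasurePreserving (fun p : Pt m × (Fin 4 → ℝ) => (p.1, p.2 - ∑ j, p.1 j))
      (volume.prod volume) (volume.prod volume) := by
    refine MeasurePreserving.skew_product (g := fun (b : Pt m) s => s - ∑ j, b j)
      (MeasurePreserving.id _) ?_ (Eventually.of_forall fun b => ?_)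
    · exact Continuous.measurable (by unfold Function.uncurry; fun_prop)
    · exact (measurePreserving_sub_right volume _).map_eq
  have h3 := h1.comp (Measure.measurePreserving_swap.comp (h2.comp Measure.measurePreserving_swap))
  refine (congrArg (fun F => MeasurePreserving F (volume.prod volume) volume) ?_).mpr h3
  ext p j : 2
  refine Fin.lastCases ?_ (fun j => ?_) j
  · rw [withSum_last]; simp [MeasurableEquiv.piFinSuccAbove]
  · rw [withSum_castSucc]; simp [MeasurableEquiv.piFinSuccAbove]

section Disintegration
variable {E : Type*} [NormedAddCommGroup E]

theorem integrable_withSum {F : Pt (m + 1) → E} (hF : Integrable F) :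
    Integrable (fun p : (Fin 4 → ℝ) × Pt m => F (withSum p.1 p.2)) (volume.prod volume) :=
  ((measurePreserving_withSum m).integrable_comp hF.aestronglyMeasurable).2 hF

theorem integral_eq_integral_withSum [NormedSpace ℝ E] {F : Pt (m + 1) → E} (hF : Integrable F) :
    ∫ k, F k = ∫ s, ∫ b : Pt m, F (withSum s b) := by
  rw [← integral_prod _ (integrable_withSum hF), ← (measurePreserving_withSum m).map_eq,
    integral_map (measurePreserving_withSum m).aemeasurable]
  · rfl
  · rw [(measurePreserving_withSum m).map_eq]
    exact hF.aestronglyMeasurable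
end Disintegration

/-- The density at `s` of the image of `φ(k) dk` under `k ↦ ∑_j k_j`. -/
def sumDensity (φ : Pt (m + 1) → ℂ) (s : Fin 4 → ℝ) : ℂ := ∫ b : Pt m, φ (withSum s b)

theorem integrable_sumDensity {φ : Pt (m + 1) → ℂ} (hφ : Integrable φ) :
    Integrable (sumDensity φ) :=
  (integrable_withSum hφ).integral_prod_left

theorem integral_smul_totalMomentum {E : Type*} [NormedAddCommGroup E] [NormedSpace ℂ E]
    [CompleteSpace E] {φ : Pt (m + 1) → ℂ} {G : (Fin 4 → ℝ) → E}
    (hG : Integrable fun k => φ k • G (totalMomentum (m + 1) k)) :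
    ∫ k, φ k • G (totalMomentum (m + 1) k) = ∫ s, sumDensity φ s • G s := by
  rw [integral_eq_integral_withSum hG]
  refine integral_congr_ae (Eventually.of_forall fun s => ?_)
  have e : ∀ b : Pt m, totalMomentum (m + 1) (withSum s b) = s := fun b => sum_withSum s b
  simp only [e]
  exact integral_smul_const _ _

/-! ### Gaussian integrals on the hyperplane of vanishing sum -/

/-- The plane wave `e^{ikx}` on `ℝ^{4n}`. -/
def planeWave (k x : Pt n) : ℂ := Complex.exp (Complex.I * (∑ j, ∑ μ, k j μ * x j μ : ℝ))

/-- The Gaussian `exp(-½ |a_1|² - ⋯ - ½ |a_n|²)`. -/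
def gaussWeight (a : Pt n) : ℝ := Real.exp (-(1 / 2) * ∑ j, ∑ μ, a j μ ^ 2)

theorem norm_planeWave (k x : Pt n) : ‖planeWave k x‖ = 1 := by
  unfold planeWave
  rw [mul_comm]
  exact Complex.norm_exp_ofReal_mul_I _

theorem continuous_planeWave : Continuous fun p : Pt n × Pt n => planeWave p.1 p.2 := by
  unfold planeWave; fun_prop

theorem continuous_gaussWeight : Continuous (gaussWeight : Pt n → ℝ) := by
  unfold gaussWeight; fun_prop

theorem planeWave_add (k x y : Pt n) :
    planeWave k (x + y) = planeWave k x * planeWave k y := by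
  unfold planeWave
  rw [← Complex.exp_add, ← mul_add, ← Complex.ofReal_add]
  simp only [Pi.add_apply, mul_add, Finset.sum_add_distrib]

theorem integrable_gaussWeight (n : ℕ) : Integrable (gaussWeight : Pt n → ℝ) := by
  have h1 : Integrable (fun x : Pt n => ∏ j, ∏ μ, Real.exp (-(1 / 2) * x j μ ^ 2)) := by
    refine Integrable.fintype_prod (f := fun _ (y : Fin 4 → ℝ) =>
      ∏ μ, Real.exp (-(1 / 2) * y μ ^ 2)) fun _ => ?_
    exact Integrable.fintype_prod (f := fun _ (y : ℝ) => Real.exp (-(1 / 2) * y ^ 2))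
      fun _ => integrable_exp_neg_mul_sq (by norm_num)
  refine h1.congr (Eventually.of_forall fun x => ?_)
  simp only [gaussWeight, ← Real.exp_sum, ← Finset.mul_sum]

theorem integral_planeWave_mul_gaussian_four {t : ℝ} (ht : 0 < t) (p : Fin 4 → ℝ) :
    ∫ y : Fin 4 → ℝ, Complex.exp (Complex.I * (∑ μ, p μ * y μ : ℝ)) *
      (Real.exp (-(t / 2) * ∑ μ, y μ ^ 2) : ℂ) =
    ((2 * Real.pi / t) ^ 2 * Real.exp (-(1 / (2 * t)) * ∑ μ, p μ ^ 2) : ℝ) := by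
  have e : ∀ y : Fin 4 → ℝ, Complex.exp (Complex.I * (∑ μ, p μ * y μ : ℝ)) *
      (Real.exp (-(t / 2) * ∑ μ, y μ ^ 2) : ℂ) =
      ∏ μ, Complex.exp ((-(t / 2) : ℂ) * (y μ : ℂ) ^ 2 + Complex.I * p μ * y μ + 0) := by
    intro y
    push_cast
    rw [← Complex.exp_add, ← Complex.exp_sum]
    congr 1
    rw [Finset.mul_sum, Finset.mul_sum, ← Finset.sum_add_distrib]
    exact Finset.sum_congr rfl fun μ _ => by ring
  simp_rw [e]
  rw [integral_fintype_prod_volume_eq_prod (f := fun μ (y : ℝ) =>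
    Complex.exp ((-(t / 2) : ℂ) * (y : ℂ) ^ 2 + Complex.I * p μ * y + 0))]
  have hre : (-(t / 2) : ℂ).re < 0 := by
    have : (-(t / 2) : ℂ) = ((-(t / 2) : ℝ) : ℂ) := by push_cast; rfl
    rw [this, Complex.ofReal_re]; linarith
  have ht' : (t : ℂ) ≠ 0 := by exact_mod_cast ht.ne'
  simp_rw [integral_cexp_quadratic hre]
  rw [Finset.prod_mul_distrib, Finset.prod_const, ← Complex.cpow_nat_mul, ← Complex.exp_sum]
  push_cast
  congr 1
  · rw [Finset.card_univ, Fintype.card_fin, neg_neg]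
    norm_num
    field_simp
  · congr 1
    rw [Finset.mul_sum]
    refine Finset.sum_congr rfl fun μ _ => ?_
    rw [mul_pow, Complex.I_sq]
    field_simp
    ring

theorem integral_planeWave_mul_gaussWeight (k : Pt n) :
    ∫ a, planeWave k a * (gaussWeight a : ℂ) =
      ((2 * Real.pi) ^ (2 * n) * Real.exp (-(1 / 2) * ∑ j, ∑ μ, k j μ ^ 2) : ℝ) := by
  have e : ∀ a : Pt n, planeWave k a * (gaussWeight a : ℂ) =
      ∏ j, Complex.exp (Complex.I * (∑ μ, k j μ * a j μ : ℝ)) *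
        (Real.exp (-(1 / 2) * ∑ μ, a j μ ^ 2) : ℂ) := by
    intro a
    rw [Finset.prod_mul_distrib, ← Complex.exp_sum, ← Complex.ofReal_prod, ← Real.exp_sum,
      ← Finset.mul_sum, ← Finset.mul_sum, ← Complex.ofReal_sum]
    rfl
  simp_rw [e]
  rw [integral_fintype_prod_volume_eq_prod (f := fun j (y : Fin 4 → ℝ) =>
    Complex.exp (Complex.I * (∑ μ, k j μ * y μ : ℝ)) *
        (Real.exp (-(1 / 2) * ∑ μ, y μ ^ 2) : ℂ))]
  simp_rw [integral_planeWave_mul_gaussian_four one_pos]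
  rw [← Complex.ofReal_prod, Finset.prod_mul_distrib, Finset.prod_const, ← Real.exp_sum,
    ← Finset.mul_sum, Finset.card_univ, Fintype.card_fin, ← pow_mul, div_one, mul_one]

theorem withSum_add_mean (s : Fin 4 → ℝ) (b : Pt m) :
    withSum s (b + fun _ => ((m + 1 : ℕ) : ℝ)⁻¹ • s) =
      withSum 0 b + fun _ => ((m + 1 : ℕ) : ℝ)⁻¹ • s := by
  ext j μ
  refine Fin.lastCases ?_ (fun j => ?_) j
  · simp only [withSum_last, Pi.add_apply, Pi.sub_apply, Finset.sum_apply,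
      Finset.sum_add_distrib, Finset.sum_const, Finset.card_univ, Fintype.card_fin, nsmul_eq_mul,
      Pi.smul_apply, smul_eq_mul, Pi.zero_apply, Pi.mul_apply, Pi.natCast_apply]
    push_cast
    field_simp
    ring
  · simp only [withSum_castSucc, Pi.add_apply]

theorem gaussWeight_add_mean {a : Pt n} (ha : ∑ j, a j = 0) (y : Fin 4 → ℝ) :
    gaussWeight (a + fun _ => y) =
      gaussWeight a * Real.exp (-(n / 2) * ∑ μ, y μ ^ 2) := by
  have ha' : ∀ μ, ∑ j, a j μ = 0 := fun μ => by rw [← Finset.sum_apply, ha]; rfl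
  unfold gaussWeight
  rw [← Real.exp_add]
  congr 1
  have e : ∀ j μ, (a j μ + y μ) ^ 2 = a j μ ^ 2 + 2 * y μ * a j μ + y μ ^ 2 := fun j μ => by ring
  have h0 : ∑ j, ∑ μ, 2 * y μ * a j μ = 0 := by
    rw [Finset.sum_comm]
    simp only [← Finset.mul_sum, ha', mul_zero, Finset.sum_const_zero]
  simp only [Pi.add_apply, e, Finset.sum_add_distrib, h0, Finset.sum_const, Finset.card_univ,
    Fintype.card_fin, nsmul_eq_mul]
  ring

theorem planeWave_const (k : Pt n) (y : Fin 4 → ℝ) :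
    planeWave k (fun _ => y) =
      Complex.exp (Complex.I * (∑ μ, totalMomentum n k μ * y μ : ℝ)) := by
  unfold planeWave
  congr 3
  rw [Finset.sum_comm]
  refine Finset.sum_congr rfl fun μ _ => ?_
  simp [totalMomentum, Finset.sum_mul]

/-- The Fourier transform of the Gaussian restricted to the hyperplane `∑_j a_j = 0`. On the
fibre `∑_j a_j = s` the Gaussian integral on `ℝ^{4n}` is, after translation by the mean `s / n`,
the one on the hyperplane times a function of `s`; so the full Gaussian integral is the product
of the integral in question and a Gaussian integral in `s`. -/
theorem integral_planeWave_withSum_zero (k : Pt (m + 1)) :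
    ∫ b : Pt m, planeWave k (withSum 0 b) * (gaussWeight (withSum 0 b) : ℂ) =
      ((2 * Real.pi) ^ (2 * m) * (((m + 1 : ℕ) : ℝ) ^ 2)⁻¹ * rKernel (m + 1) k : ℝ) := by
  set N : ℝ := ((m + 1 : ℕ) : ℝ) with hN
  have hN0 : 0 < N := by rw [hN]; positivity
  set K := totalMomentum (m + 1) k with hK
  set J := ∫ b : Pt m, planeWave k (withSum 0 b) * (gaussWeight (withSum 0 b) : ℂ) with hJ
  have hint : Integrable fun a : Pt (m + 1) => planeWave k a * (gaussWeight a : ℂ) := by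
    refine (integrable_gaussWeight (m + 1)).ofReal.bdd_mul (c := 1) ?_
      (Eventually.of_forall fun a => (norm_planeWave k a).le)
    exact (continuous_planeWave.comp (Continuous.prodMk_right k)).aestronglyMeasurable
  have h1 := integral_planeWave_mul_gaussWeight k
  rw [integral_eq_integral_withSum hint] at h1
  have h2 : ∀ s : Fin 4 → ℝ,
      ∫ b : Pt m, planeWave k (withSum s b) * (gaussWeight (withSum s b) : ℂ) =
      J * (Complex.exp (Complex.I * (∑ μ, (N⁻¹ * K μ) * s μ : ℝ)) *
        (Real.exp (-(N⁻¹ / 2) * ∑ μ, s μ ^ 2) : ℂ)) := by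
    intro s
    rw [← integral_add_right_eq_self _ (fun _ => N⁻¹ • s : Pt m), hJ, ← integral_mul_const]
    refine integral_congr_ae (Eventually.of_forall fun b => ?_)
    simp only [hN, withSum_add_mean, planeWave_add, planeWave_const,
      gaussWeight_add_mean (sum_withSum 0 b)]
    simp only [← hN, ← hK]
    have e1 : ∑ μ, K μ * (N⁻¹ • s) μ = ∑ μ, (N⁻¹ * K μ) * s μ :=
      Finset.sum_congr rfl fun μ _ => by simp only [Pi.smul_apply, smul_eq_mul]; ring
    have e2 : -(N / 2) * ∑ μ, (N⁻¹ • s) μ ^ 2 = -(N⁻¹ / 2) * ∑ μ, s μ ^ 2 := by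
      simp only [Pi.smul_apply, smul_eq_mul, mul_pow, ← Finset.mul_sum]
      field_simp
    rw [e1, e2]
    push_cast
    ring
  simp_rw [h2] at h1
  rw [integral_const_mul, integral_planeWave_mul_gaussian_four (inv_pos.2 hN0)] at h1
  have hne : ((((2 * Real.pi / N⁻¹) ^ 2 * Real.exp (-(1 / (2 * N⁻¹)) * ∑ μ, (N⁻¹ * K μ) ^ 2) : ℝ))
      : ℂ) ≠ 0 := by
    exact_mod_cast (by positivity : (0 : ℝ) < _).ne'
  refine mul_right_cancel₀ hne (h1.trans ?_)
  rw [← Complex.ofReal_mul]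
  congr 1
  have e3 : Real.exp (-(1 / 2) * ∑ j, ∑ μ, k j μ ^ 2) =
      rKernel (m + 1) k * Real.exp (-(1 / (2 * N⁻¹)) * ∑ μ, (N⁻¹ * K μ) ^ 2) := by
    unfold rKernel
    rw [← Real.exp_add]
    congr 1
    have e4 : ∀ μ, ∑ j, ∑ l, k j μ * k l μ = K μ ^ 2 := fun μ => by
      rw [← Finset.sum_mul_sum, sq, hK]
      simp [totalMomentum]
    simp only [e4]
    simp only [Finset.sum_sub_distrib, mul_pow, ← Finset.mul_sum, ← hN]
    rw [Finset.sum_comm]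
    field_simp
    ring
  rw [e3]
  field_simp
  ring

/-! ### The position-space kernel -/

theorem gaussWeight_withSum_le (s : Fin 4 → ℝ) (b : Pt m) :
    gaussWeight (withSum s b) ≤ gaussWeight b := by
  refine Real.exp_le_exp.2 ?_
  rw [Fin.sum_univ_castSucc]
  simp only [withSum_castSucc]
  have : 0 ≤ ∑ μ, withSum s b (Fin.last m) μ ^ 2 := Finset.sum_nonneg fun μ _ => sq_nonneg _
  linarith

theorem continuous_withSum_zero : Continuous (withSum 0 : Pt m → Pt (m + 1)) := by
  refine continuous_pi fun j => ?_
  refine Fin.lastCases ?_ (fun j => ?_) j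
  · simp only [withSum_last]; fun_prop
  · simp only [withSum_castSucc]; fun_prop

theorem integrable_gaussWeight_withSum_zero (m : ℕ) :
    Integrable fun b : Pt m => gaussWeight (withSum 0 b) := by
  refine (integrable_gaussWeight m).mono'
    (continuous_gaussWeight.comp continuous_withSum_zero).aestronglyMeasurable
    (Eventually.of_forall fun b => ?_)
  exact (Real.norm_of_nonneg (Real.exp_nonneg _)).trans_le (gaussWeight_withSum_le 0 b)

theorem integral_deltaMean (g : Pt (m + 1) → ℂ) (hg : Continuous g) :
    ∫ a, g a ∂(deltaMean (m + 1)) = ((m + 1 : ℕ) : ℂ) ^ 4 * ∫ b : Pt m, g (withSum 0 b) := by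
  have e : (fun b : Pt m => (Fin.snoc b (-∑ j, b j) : Pt (m + 1))) = withSum 0 := by
    funext b
    simp [withSum]
  rw [deltaMean, e, integral_smul_measure, integral_map
    continuous_withSum_zero.measurable.aemeasurable hg.aestronglyMeasurable]
  rw [Complex.real_smul, ENNReal.toReal_pow, ENNReal.toReal_natCast]
  push_cast
  rfl

/-- Both sides are `∫ dk f̌(k) e^{ikx}` times the Fourier transform at `k` of the Gaussian on
`∑_j a_j = 0`, which is `r_n(k)` up to the normalization `c_n`. -/
theorem integral_deltaMean_gaussWeight (f : C₀(Pt (m + 1), ℂ)) {φ : Pt (m + 1) → ℂ}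
    (hf : HasCheck f φ) (x : Fin 4 → ℝ) :
    (cConst (m + 1) : ℂ) * ∫ a, f (fun j => x + a j) * (gaussWeight a : ℂ) ∂(deltaMean (m + 1)) =
      ∫ k, (φ k * (rKernel (m + 1) k : ℂ)) *
        Complex.exp (Complex.I * (∑ μ, totalMomentum (m + 1) k μ * x μ : ℝ)) := by
  have hc : Continuous fun a : Pt (m + 1) => f (fun j => x + a j) * (gaussWeight a : ℂ) := by
    refine (f.continuous.comp (by fun_prop)).mul ?_
    exact Complex.continuous_ofReal.comp continuous_gaussWeight
  rw [integral_deltaMean _ hc]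
  have hprod : Integrable (fun p : Pt m × Pt (m + 1) =>
      planeWave p.2 ((fun _ => x) + withSum 0 p.1) *
        ((gaussWeight (withSum 0 p.1) : ℂ) * φ p.2)) (volume.prod volume) := by
    have hg : Integrable fun b : Pt m => (gaussWeight (withSum 0 b) : ℂ) :=
      (integrable_gaussWeight_withSum_zero m).ofReal
    have hw : Continuous fun p : Pt m × Pt (m + 1) =>
        planeWave p.2 ((fun _ => x) + withSum 0 p.1) :=
      continuous_planeWave.comp (continuous_snd.prodMk
        (continuous_const.add (continuous_withSum_zero.comp continuous_fst)))
    exact (hg.mul_prod hf.1).bdd_mul (c := 1) hw.aestronglyMeasurable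
      (Eventually.of_forall fun p => (norm_planeWave _ _).le)
  have h1 : ∫ b : Pt m, f (fun j => x + withSum 0 b j) * (gaussWeight (withSum 0 b) : ℂ) =
      ∫ b : Pt m, ∫ k : Pt (m + 1), planeWave k ((fun _ => x) + withSum 0 b) *
        ((gaussWeight (withSum 0 b) : ℂ) * φ k) := by
    refine integral_congr_ae (Eventually.of_forall fun b => ?_)
    change f _ * _ = _
    rw [hf.2, ← integral_mul_const]
    refine integral_congr_ae (Eventually.of_forall fun k => ?_)
    change φ k * planeWave k _ * _ = _
    rw [show (fun j => x + withSum 0 b j) = (fun _ => x) + withSum 0 b from rfl]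
    ring
  rw [h1, integral_integral_swap hprod, ← mul_assoc, ← integral_const_mul]
  refine integral_congr_ae (Eventually.of_forall fun k => ?_)
  change _ * (∫ b : Pt m, _) = _
  have h2 : ∀ b : Pt m, planeWave k ((fun _ => x) + withSum 0 b) *
      ((gaussWeight (withSum 0 b) : ℂ) * φ k) =
      (planeWave k (withSum 0 b) * (gaussWeight (withSum 0 b) : ℂ)) *
        (φ k * planeWave k fun _ => x) := fun b => by
    rw [planeWave_add]; ring
  simp_rw [h2]
  rw [integral_mul_const, integral_planeWave_withSum_zero, planeWave_const]
  have hN : ((m + 1 : ℕ) : ℂ) ≠ 0 := Nat.cast_ne_zero.2 m.succ_ne_zero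
  have hpi : (Real.pi : ℂ) ≠ 0 := Complex.ofReal_ne_zero.2 Real.pi_ne_zero
  have hC : (cConst (m + 1) : ℂ) * ((m + 1 : ℕ) : ℂ) ^ 4 *
      (((2 * Real.pi) ^ (2 * m) * (((m + 1 : ℕ) : ℝ) ^ 2)⁻¹ : ℝ) : ℂ) = 1 := by
    unfold cConst
    rw [Nat.add_sub_cancel]
    push_cast at hN ⊢
    field_simp
  rw [Complex.ofReal_mul]
  linear_combination (rKernel (m + 1) k * φ k *
    Complex.exp (Complex.I * (∑ μ, totalMomentum (m + 1) k μ * x μ : ℝ)) : ℂ) * hC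

/-! ### Fourier integrals of integrable functions on `ℝ⁴` -/

theorem tendsto_fourier_four_cocompact (φ : (Fin 4 → ℝ) → ℂ) :
    Tendsto (fun x : Fin 4 → ℝ =>
      ∫ k : Fin 4 → ℝ, φ k * Complex.exp (Complex.I * (∑ μ, k μ * x μ : ℝ)))
      (cocompact _) (𝓝 0) := by
  -- `x ↦ -(2π)⁻¹ ⟨·, x⟩` is a homeomorphism onto a closed subset of the dual space
  let T : (Fin 4 → ℝ) → StrongDual ℝ (Fin 4 → ℝ) := fun x =>
    ∑ μ, (-(2 * Real.pi)⁻¹ * x μ) • ContinuousLinearMap.proj (R := ℝ) (φ := fun _ => ℝ) μ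
  have hTapp : ∀ x k, T x k = -(2 * Real.pi)⁻¹ * ∑ μ, k μ * x μ := fun x k => by
    simp only [T, sum_apply, smul_apply,
      ContinuousLinearMap.proj_apply, smul_eq_mul, Finset.mul_sum]
    exact Finset.sum_congr rfl fun μ _ => by ring
  have hT : Continuous T := by fun_prop
  let S : StrongDual ℝ (Fin 4 → ℝ) → (Fin 4 → ℝ) := fun w μ => -(2 * Real.pi) * w (Pi.single μ 1)
  have hS : Continuous S := by
    refine continuous_pi fun μ => continuous_const.mul ?_
    exact (ContinuousLinearMap.apply ℝ ℝ (Pi.single μ 1 : Fin 4 → ℝ)).continuous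
  have hST : Function.LeftInverse S T := fun x => by
    funext μ
    simp only [S, hTapp]
    have : ∑ ν, (Pi.single μ 1 : Fin 4 → ℝ) ν * x ν = x μ := by simp [Pi.single_apply]
    rw [this]
    field_simp
  have h := (tendsto_integral_exp_smul_cocompact φ volume).comp
    (hST.isClosedEmbedding hS hT).tendsto_cocompact
  refine h.congr fun x => integral_congr_ae (Eventually.of_forall fun k => ?_)
  simp only [hTapp, Circle.smul_def, Real.fourierChar_apply, smul_eq_mul]
  rw [mul_comm]
  congr 2
  push_cast
  field_simp

/-- The Fourier integral of an integrable function on `ℝ⁴`, as an element of `C₀(ℝ⁴)`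
(Riemann–Lebesgue). -/
def fourierFour (φ : (Fin 4 → ℝ) → ℂ) (hφ : Integrable φ) : C₀(Fin 4 → ℝ, ℂ) where
  toFun x := ∫ k : Fin 4 → ℝ, φ k * Complex.exp (Complex.I * (∑ μ, k μ * x μ : ℝ))
  continuous_toFun := by
    refine continuous_of_dominated (bound := fun k => ‖φ k‖) (fun x => ?_)
      (fun x => Eventually.of_forall fun k => ?_) hφ.norm
      (Eventually.of_forall fun k => by fun_prop)
    · exact hφ.aestronglyMeasurable.mul (Continuous.aestronglyMeasurable (by fun_prop))
    · rw [norm_mul, mul_comm Complex.I, Complex.norm_exp_ofReal_mul_I, mul_one]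
  zero_at_infty' := tendsto_fourier_four_cocompact φ

/-! ### Compactness of `Σ₁` and membership in `ℰ₁` -/

theorem isCompact_orthogonalGroup (ι : Type*) [Fintype ι] [DecidableEq ι] :
    IsCompact (Matrix.orthogonalGroup ι ℝ : Set (Matrix ι ι ℝ)) := by
  have hK : IsCompact (Set.univ.pi fun _ : ι => Set.univ.pi fun _ : ι => Set.Icc (-1 : ℝ) 1) :=
    isCompact_univ_pi fun _ => isCompact_univ_pi fun _ => isCompact_Icc
  have hc : IsClosed (Matrix.orthogonalGroup ι ℝ : Set (Matrix ι ι ℝ)) := by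
    have : (Matrix.orthogonalGroup ι ℝ : Set (Matrix ι ι ℝ)) = {A | A * star A = 1} := by
      ext A
      exact Matrix.mem_orthogonalGroup_iff ι ℝ
    rw [this]
    exact isClosed_eq (by fun_prop) continuous_const
  refine hK.of_isClosed_subset hc fun A hA i _ j _ => ?_
  have h := entry_norm_bound_of_unitary (𝕜 := ℝ) hA i j
  exact abs_le.1 h

instance : CompactSpace SigOne := by
  refine isCompact_iff_compactSpace.1 ?_
  have hs : Continuous spatial := by
    refine continuous_matrix fun i j => ?_
    fin_cases i <;> fin_cases j <;> simp [spatial] <;> fun_prop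
  have e : SigOne = (fun R => spatial R * sigmaZero * (spatial R)ᵀ) ''
      (Matrix.orthogonalGroup (Fin 3) ℝ : Set _) := by
    ext σ
    constructor
    · rintro ⟨R, hR, rfl⟩
      exact ⟨R, hR, rfl⟩
    · rintro ⟨R, hR, rfl⟩
      exact ⟨R, hR, rfl⟩
  rw [e]
  exact (isCompact_orthogonalGroup _).image (by fun_prop)

/-- As `Σ₁` is compact, `1 ∈ C₀(Σ₁)`, and `ℰ₁` contains the quantized functions themselves. -/
theorem quantize_one_mem_symbolAlgebra {S : Set (Matrix (Fin 4) (Fin 4) ℝ)} [CompactSpace S]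
    {φ : Pt m → ℂ} (hφ : Integrable φ) :
    quantize (1 : S →ᵇ ℂ) (ContinuousMap.id _) φ ∈ symbolAlgebra S m := by
  let g : C₀(S, ℂ) := ⟨1, by simp⟩
  have : g.toBCF = 1 := rfl
  rw [← this]
  exact quantize_mem g hφ

/-- The substitution `k = √n p` turns `h(q̃) = h(q / √n)` into a function of `q`. -/
theorem ofTilde_mem_symbolAlgebra (hn : n ≠ 0) {φ : (Fin 4 → ℝ) → ℂ} (hφ : Integrable φ) :
    ofTilde n φ ∈ symbolAlgebra SigOne 1 := by
  have hs : 0 < √(n : ℝ) := Real.sqrt_pos.2 (by positivity)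
  have hmp := volume_preserving_funUnique (Fin 1) (Fin 4 → ℝ)
  let ψ : Pt 1 → ℂ := fun p => ((√(n : ℝ)) ^ 4 : ℂ) * φ (√(n : ℝ) • p 0)
  have hψ : Integrable ψ := by
    have h1 : Integrable fun q : Fin 4 → ℝ => φ (√(n : ℝ) • q) := hφ.comp_smul hs.ne'
    exact ((hmp.integrable_comp h1.aestronglyMeasurable).2 h1).const_mul _
  have : ofTilde n φ = quantize 1 (ContinuousMap.id _) ψ := by
    refine Sections.ext fun π => ContinuousLinearMap.ext fun v => ?_
    unfold ofTilde
    rw [eval_quantize_one, eval_quantize_one, WeylRep.smear_apply _ _ hφ,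
      WeylRep.smear_apply _ _ hψ]
    set G : (Fin 4 → ℝ) → π.2.K := fun k => φ k • π.2.W (tildeMomentum n k) v with hG
    have h1 : ∀ p : Pt 1, ψ p • π.2.W (ContinuousMap.id (Pt 1) p) v =
        ((√(n : ℝ)) ^ 4 : ℝ) • G (√(n : ℝ) • MeasurableEquiv.funUnique (Fin 1) (Fin 4 → ℝ) p) := by
      intro p
      have e : tildeMomentum n (√(n : ℝ) • MeasurableEquiv.funUnique (Fin 1) (Fin 4 → ℝ) p)
          = p := by
        funext i
        rw [Subsingleton.elim i 0]
        exact inv_smul_smul₀ hs.ne' _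
      simp only [hG, e]
      rw [← Complex.coe_smul, smul_smul]
      push_cast
      rfl
    simp_rw [h1]
    have h2 : ∫ p : Pt 1, G (√(n : ℝ) • MeasurableEquiv.funUnique (Fin 1) (Fin 4 → ℝ) p) =
        ∫ q, G (√(n : ℝ) • q) := hmp.integral_comp' (g := fun q => G (√(n : ℝ) • q))
    rw [integral_smul, h2, Measure.integral_comp_smul, smul_smul, abs_of_nonneg (by positivity)]
    rw [Module.finrank_fintype_fun_eq_card, Fintype.card_fin, mul_inv_cancel₀ (by positivity),
      one_smul]
  rw [this]
  exact quantize_one_mem_symbolAlgebra hψ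

/-- Integrating over the momenta with a given sum turns `∫ dk φ(k) e^{i(∑_j k_j) q̃}` into a
function of `q̃`. -/
theorem quantize_totalMomentum {φ : Pt (m + 1) → ℂ} (hφ : Integrable φ) :
    (quantize 1 ((tildeMomentum (m + 1)).comp (totalMomentum (m + 1))) φ : Sections SigOne 1) =
      ofTilde (m + 1) (sumDensity φ) := by
  refine Sections.ext fun π => ContinuousLinearMap.ext fun v => ?_
  unfold ofTilde
  rw [eval_quantize_one, eval_quantize_one, WeylRep.smear_apply _ _ hφ,
    WeylRep.smear_apply _ _ (integrable_sumDensity hφ)]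
  exact integral_smul_totalMomentum (G := fun s => π.2.W (tildeMomentum (m + 1) s) v)
    (π.2.integrable_smul ((tildeMomentum (m + 1)).comp (totalMomentum (m + 1))) hφ v)

end QuantumSpacetime
end

/-! ### The quantum diagonal map on functions of the coordinates -/

theorem mainTheorem1 (n : ℕ) (hn : 1 ≤ n) (f : ZeroAtInftyContinuousMap (Pt n) ℂ) (fc : Pt n → ℂ)
    (hf : HasCheck f fc) :
    quantumDiagonalMap n (ofCoordinates n fc) =
        quantize 1 ((tildeMomentum n).comp (totalMomentum n)) (fun k => fc k * (rKernel n k : ℂ)) ∧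
    (∃ (h : ZeroAtInftyContinuousMap (Fin 4 → ℝ) ℂ) (hc : (Fin 4 → ℝ) → ℂ),
      HasCheck₄ h hc ∧
      (∀ x, h x = (cConst n : ℂ) * ∫ a, f (fun j => x + a j) *
        (Real.exp (-(1 / 2) * ∑ j, ∑ μ, a j μ ^ 2) : ℂ) ∂(deltaMean n)) ∧
      quantumDiagonalMap n (ofCoordinates n fc) = ofTilde n hc) ∧
    quantumDiagonalMap n (ofCoordinates n fc) ∈ symbolAlgebra SigOne 1 ∧
    (∃ Hc, HasSymbol n (quantumDiagonalMap n (ofCoordinates n fc)) Hc ∧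
      ∀ σ σ', Hc σ = Hc σ') := by
  have hn0 : n ≠ 0 := by omega
  obtain ⟨m, rfl⟩ := Nat.exists_eq_succ_of_ne_zero hn0
  have hφ := integrable_mul_rKernel hn0 hf.1
  have h1 := quantumDiagonalMap_ofCoordinates hn0 hf.1
  have h2 := h1.trans (quantize_totalMomentum hφ)
  have hd := integrable_sumDensity hφ
  refine ⟨h1, ⟨fourierFour _ hd, _, ⟨hd, fun _ => rfl⟩, fun x => ?_, h2⟩, ?_, ?_⟩
  · refine Eq.trans ?_ (integral_deltaMean_gaussWeight f hf x).symm
    refine (integral_smul_totalMomentum (G := fun s : Fin 4 → ℝ =>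
      Complex.exp (Complex.I * (∑ μ, s μ * x μ : ℝ))) ?_).symm
    refine hφ.mul_bdd (c := 1) (Continuous.aestronglyMeasurable ?_)
      (Eventually.of_forall fun k => ?_)
    · exact Continuous.comp (g := fun s : Fin 4 → ℝ =>
        Complex.exp (Complex.I * (∑ μ, s μ * x μ : ℝ))) (by fun_prop)
        (totalMomentum (m + 1)).continuous
    · rw [mul_comm Complex.I, Complex.norm_exp_ofReal_mul_I]
  · rw [h2]
    exact ofTilde_mem_symbolAlgebra hn0 hd
  · refine ⟨fun _ => _, ⟨fun _ => hd, fun π => ?_⟩, fun _ _ => rfl⟩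
    rw [h2]
    exact eval_quantize_one _ _ π
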